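/- Let $\mathcal{O}$ be a complete discrete valuation ring of characteristic $0$ with residue field of prime characteristic $p$. Let $G,G'$ be finite groups, $\omega:G\to\Gamma$ and $\omega':G'\to\Gamma$ surjective group homomorphisms, $N=\ker\omega$, $N'=\ker\omega'$, and $\ddot G=\{(g,g')\in G\times G'\mid \omega(g)=\omega'(g')\}$. Let $b$ be a $G$-invariant block of $\mathcal{O}N$ (a primitive idempotent of $Z(\mathcal{O}N)$ fixed under conjugation by $G$) and $b'$ a $G'$-invariant block of $\mathcal{O}N'$. The algebras $A=\mathcal{O}Gb$ and $A'=\mathcal{O}G'b'$ are $\Gamma$-graded, $A_x$ and $A'_x$ being the sets of elements supported on $\omega^{-1}(x)$ and $\omega'^{-1}(x)$. An $\mathcal{O}(G\times G')$-module $\ddot M$ is viewed as an $(\mathcal{O}G,\mathcal{O}G')$-bimodule by $g\,m\,g'=(g,g'^{-1})m$; it is $\Gamma$-graded if $\ddot M=\bigoplus_{x\in\Gamma}\ddot M_x$ with $g\,\ddot M_x\,g'\subseteq\ddot M_{\omega(g)x\omega'(g')}$. Its $1$-component $M=\ddot M_1$ is then an $\mathcal{O}\ddot G$-module (and $\ddot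 M\cong\operatorname{Ind}_{\ddot G}^{G\times G'}M$). We say that $\ddot M$ *determines a basic $\Gamma$-graded Morita equivalence* between $A$ and $A'$ if 1. $b$ acts on $\ddot M$ as the identity on the left and $b'$ acts as the identity on the right; $M$ is finitely generated over $\mathcal{O}$, indecomposable as an $\mathcal{O}(N\times N')$-module, and projective as an $\mathcal{O}(N\times 1)$-module and as an $\mathcal{O}(1\times N')$-module; 2. $\ddot M$ induces a $\Gamma$-graded Morita equivalence: there is a $\Gamma$-graded $(A',A)$-bimodule $\ddot M'$ such that $\ddot M\otimes_{A'}\ddot M'\cong A$ and $\ddot M'\otimes_A\ddot M\cong A'$ as $\Gamma$-graded bimodules; 3. for a vertex $\ddot P\le\ddot G$ of the indecomposable $\mathcal{O}\ddot G$-module $M$ (equivalently, for every vertex), the projection $\sigma:\ddot P\to P$ onto the image $P$ of $\ddot P$ in $G$ is an isomorphism. **Corollary.** Assume that the $\Gamma$-graded $\mathcal{O}(G\times G')$-module $\ddot M$ determines a basic $\Gamma$-graded Morita equivalence between $A$ and $A'$. Let $\Lambda\le\Gamma$ be a subgroup, $H=\omega^{-1}(\Lambda)$ and $H'=\omega'^{-1}(\Lambda)$.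 Then the $\Lambda$-graded $\mathcal{O}(H\times H')$-module $\ddot M_\Lambda=\bigoplus_{x\in\Lambda}\ddot M_x$ determines a basic $\Lambda$-graded Morita equivalence between $A_\Lambda=\mathcal{O}Hb$ and $A'_\Lambda=\mathcal{O}H'b'$ (with respect to the restrictions $H\to\Lambda$ and $H'\to\Lambda$ of $\omega$ and $\omega'$, whose kernels are again $N$ and $N'$). -/

import Mathlib

open scoped TensorProduct MonoidAlgebra

noncomputable section

namespace GradedMorita

universe u v

/-! ### Bimodules over algebras, their tensor products, and graded Morita equivalences -/

section Bimodules

variable {O : Type*} [CommRing O]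

/-- The structure of an `(A, B)`-bimodule on the `O`-module `X`, with `O` acting centrally:
`a x = left a x` and `x b = (right b).unop x`. -/
structure AlgBimod (O A B X : Type*) [CommRing O] [Ring A] [Algebra O A] [Ring B] [Algebra O B]
    [AddCommGroup X] [Module O X] where
  left : A →ₐ[O] Module.End O X
  right : B →ₐ[O] (Module.End O X)ᵐᵒᵖ
  comm : ∀ (a : A) (b : B) (x : X), left a ((right b).unop x) = (right b).unop (left a x)

variable {A B C X Y : Type*} [Ring A] [Algebra O A] [Ring B] [Algebra O B] [Ring C] [Algebra O C]
  [AddCommGroup X] [Module O X] [AddCommGroup Y] [Module O Y]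

namespace AlgBimod

/-- The `O`-submodule of `X ⊗[O] Y` spanned by all `x b ⊗ y - x ⊗ b y`. -/
def balancing (β : AlgBimod O A B X) (γ : AlgBimod O B C Y) : Submodule O (X ⊗[O] Y) :=
  Submodule.span O {t | ∃ (x : X) (b : B) (y : Y),
    t = (β.right b).unop x ⊗ₜ[O] y - x ⊗ₜ[O] γ.left b y}

/-- The tensor product `X ⊗_B Y` of an `(A, B)`-bimodule and a `(B, C)`-bimodule. -/
abbrev Tensor (β : AlgBimod O A B X) (γ : AlgBimod O B C Y) : Type _ := (X ⊗[O] Y) ⧸ balancing β γ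

/-- The element `x ⊗ y` of `X ⊗_B Y`. -/
def tmul (β : AlgBimod O A B X) (γ : AlgBimod O B C Y) (x : X) (y : Y) : Tensor β γ :=
  (balancing β γ).mkQ (x ⊗ₜ[O] y)

lemma balancing_left (β : AlgBimod O A B X) (γ : AlgBimod O B C Y) (a : A) :
    balancing β γ ≤ (balancing β γ).comap ((β.left a).rTensor Y) := by
  refine Submodule.span_le.mpr ?_
  rintro _ ⟨x, b, y, rfl⟩
  refine Submodule.subset_span ⟨β.left a x, b, y, ?_⟩
  simp [β.comm]

lemma balancing_right (β : AlgBimod O A B X) (γ : AlgBimod O B C Y) (c : C) :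
    balancing β γ ≤ (balancing β γ).comap ((γ.right c).unop.lTensor X) := by
  refine Submodule.span_le.mpr ?_
  rintro _ ⟨x, b, y, rfl⟩
  refine Submodule.subset_span ⟨x, b, (γ.right c).unop y, ?_⟩
  simp [γ.comm]

/-- The `(A, C)`-bimodule structure on `X ⊗_B Y`: `a (x ⊗ y) c = a x ⊗ y c`. -/
def tensor (β : AlgBimod O A B X) (γ : AlgBimod O B C Y) : AlgBimod O A C (Tensor β γ) where
  left := AlgHom.ofLinearMap
    { toFun := fun a => (balancing β γ).mapQ _ _ (balancing_left β γ a)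
      map_add' := fun a a' => by
        refine Submodule.linearMap_qext _ (TensorProduct.ext' fun x y => ?_)
        simp
      map_smul' := fun r a => by
        refine Submodule.linearMap_qext _ (TensorProduct.ext' fun x y => ?_)
        simp only [map_smul, LinearMap.rTensor_smul]; rfl }
    (by
      refine Submodule.linearMap_qext _ (TensorProduct.ext' fun x y => ?_)
      simp)
    (fun a a' => by
      refine Submodule.linearMap_qext _ (TensorProduct.ext' fun x y => ?_)
      simp)
  right := AlgHom.ofLinearMap
    { toFun := fun c => MulOpposite.op ((balancing β γ).mapQ _ _ (balancing_right β γ c))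
      map_add' := fun c c' => by
        refine MulOpposite.unop_injective ?_
        refine Submodule.linearMap_qext _ (TensorProduct.ext' fun x y => ?_)
        simp
      map_smul' := fun r c => by
        refine MulOpposite.unop_injective ?_
        refine Submodule.linearMap_qext _ (TensorProduct.ext' fun x y => ?_)
        simp }
    (by
      refine MulOpposite.unop_injective ?_
      refine Submodule.linearMap_qext _ (TensorProduct.ext' fun x y => ?_)
      simp)
    (fun c c' => by
      refine MulOpposite.unop_injective ?_
      refine Submodule.linearMap_qext _ (TensorProduct.ext' fun x y => ?_)
      simp)
  comm a c t := by
    obtain ⟨t, rfl⟩ := Submodule.mkQ_surjective _ t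
    induction t with
    | zero => simp
    | add s t hs ht => simp only [map_add, hs, ht]
    | tmul x y => simp

/-- The regular `(A, A)`-bimodule `A`. -/
def regular (O A : Type*) [CommRing O] [Ring A] [Algebra O A] : AlgBimod O A A A where
  left := Algebra.lmul O A
  right := AlgHom.ofLinearMap
    { toFun := fun a => MulOpposite.op (LinearMap.mulRight O a)
      map_add' := fun a a' => by
        refine MulOpposite.unop_injective (LinearMap.ext fun x => ?_)
        simp [mul_add]
      map_smul' := fun r a => by
        refine MulOpposite.unop_injective (LinearMap.ext fun x => ?_)
        simp }
    (by
      refine MulOpposite.unop_injective (LinearMap.ext fun x => ?_)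
      simp)
    (fun a a' => by
      refine MulOpposite.unop_injective (LinearMap.ext fun x => ?_)
      simp [mul_assoc])
  comm a b x := by simp [mul_assoc]

end AlgBimod

variable {Γ : Type*} [Group Γ]

open Classical in
/-- `𝒳` is a `Γ`-grading of the `(A, B)`-bimodule `X`, for given `Γ`-gradings of `A` and `B`:
`X = ⨁ₓ 𝒳 x` and `A_x X_y ⊆ X_{xy}`, `X_y B_z ⊆ X_{yz}`. -/
structure AlgBimod.IsGraded (β : AlgBimod O A B X) (𝒜 : Γ → Submodule O A) (ℬ : Γ → Submodule O B)
    (𝒳 : Γ → Submodule O X) : Prop where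
  internal : DirectSum.IsInternal 𝒳
  left_mem : ∀ x y, ∀ a ∈ 𝒜 x, ∀ m ∈ 𝒳 y, β.left a m ∈ 𝒳 (x * y)
  right_mem : ∀ y z, ∀ m ∈ 𝒳 y, ∀ b ∈ ℬ z, (β.right b).unop m ∈ 𝒳 (y * z)

/-- The grading of `X ⊗_B Y`: the component of degree `z` is spanned by the `x ⊗ y` with
`x`, `y` homogeneous and `deg x * deg y = z`. -/
def tensorGrading (β : AlgBimod O A B X) (γ : AlgBimod O B C Y) (𝒳 : Γ → Submodule O X)
    (𝒴 : Γ → Submodule O Y) (z : Γ) : Submodule O (AlgBimod.Tensor β γ) :=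
  Submodule.span O {t | ∃ s r : Γ, s * r = z ∧ ∃ x ∈ 𝒳 s, ∃ y ∈ 𝒴 r, t = AlgBimod.tmul β γ x y}

/-- Two graded `(A, B)`-bimodules are isomorphic: there is an isomorphism of bimodules which
carries each homogeneous component onto the component of the same degree. -/
def GradedIso (β : AlgBimod O A B X) (𝒳 : Γ → Submodule O X) (γ : AlgBimod O A B Y)
    (𝒴 : Γ → Submodule O Y) : Prop :=
  ∃ e : X ≃ₗ[O] Y, (∀ a x, e (β.left a x) = γ.left a (e x)) ∧
    (∀ b x, e ((β.right b).unop x) = (γ.right b).unop (e x)) ∧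
    ∀ z, (𝒳 z).map (e : X →ₗ[O] Y) = 𝒴 z

/-- The bimodule `X` with the grading `𝒳` induces a `Γ`-graded Morita equivalence between the
`Γ`-graded algebras `A` and `B`: it is a `Γ`-graded `(A, B)`-bimodule, and there is a `Γ`-graded
`(B, A)`-bimodule `Y` such that `X ⊗_B Y ≃ A` and `Y ⊗_A X ≃ B` as `Γ`-graded bimodules. -/
def InducesGradedMorita {X : Type v} [AddCommGroup X] [Module O X] (β : AlgBimod O A B X)
    (𝒜 : Γ → Submodule O A) (ℬ : Γ → Submodule O B) (𝒳 : Γ → Submodule O X) : Prop :=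
  β.IsGraded 𝒜 ℬ 𝒳 ∧
  ∃ (Y : Type v) (_ : AddCommGroup Y) (_ : Module O Y) (γ : AlgBimod O B A Y)
    (𝒴 : Γ → Submodule O Y), γ.IsGraded ℬ 𝒜 𝒴 ∧
    GradedIso (β.tensor γ) (tensorGrading β γ 𝒳 𝒴) (AlgBimod.regular O A) 𝒜 ∧
    GradedIso (γ.tensor β) (tensorGrading γ β 𝒴 𝒳) (AlgBimod.regular O B) ℬ

end Bimodules

/-! ### The algebras `O G b` -/

section Corner

variable {O R : Type*} [CommRing O] [Ring R] [Algebra O R] {e : R} (he : IsIdempotentElem e)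

lemma corner_smul_mem (r : O) {a : R} (ha : a ∈ Subsemigroup.corner e) :
    r • a ∈ Subsemigroup.corner e := by
  obtain ⟨c, rfl⟩ := ha
  exact ⟨r • c, by simp⟩

instance cornerModule : Module O he.Corner where
  smul r a := ⟨r • a.1, corner_smul_mem r a.2⟩
  one_smul a := Subtype.ext (one_smul O a.1)
  mul_smul r s a := Subtype.ext (mul_smul r s a.1)
  smul_zero r := Subtype.ext (smul_zero r)
  smul_add r a b := Subtype.ext (smul_add r a.1 b.1)
  add_smul r s a := Subtype.ext (add_smul r s a.1)
  zero_smul a := Subtype.ext (zero_smul O a.1)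

/-- The corner algebra `e R e` (which is `R e` when `e` is central), with identity `e`. -/
instance cornerAlgebra : Algebra O he.Corner :=
  Algebra.ofModule (fun r a b => Subtype.ext (smul_mul_assoc r a.1 b.1))
    (fun r a b => Subtype.ext (mul_smul_comm r a.1 b.1))

/-- The inclusion of the corner algebra, as an `O`-linear map. -/
def cornerIncl : he.Corner →ₗ[O] R where
  toFun a := a.1
  map_add' _ _ := rfl
  map_smul' _ _ := rfl

/-- An algebra homomorphism `f` with `f e = 1` restricts to a (unital) homomorphism on the corner
algebra of `e`. -/
def cornerRestrict {S : Type*} [Ring S] [Algebra O S] (f : R →ₐ[O] S) (hf : f e = 1) :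
    he.Corner →ₐ[O] S :=
  AlgHom.ofLinearMap (f.toLinearMap ∘ₗ cornerIncl he) hf (fun a b => map_mul f a.1 b.1)

end Corner

section Blocks

variable {O : Type*} [CommRing O] {G Γ : Type*} [Group G] [Group Γ]

/-- `b` is a block of the group algebra `O N`: a primitive idempotent of its centre. -/
structure IsBlock {N : Type*} [Group N] (b : O[N]) : Prop where
  idem : IsIdempotentElem b
  central : b ∈ Subalgebra.center O O[N]
  ne_zero : b ≠ 0
  primitive : ∀ e ∈ Subalgebra.center O O[N], IsIdempotentElem e → e * b = e → e = 0 ∨ e = b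

/-- `b` is a block of `O N`, where `N = ker ω`, invariant under conjugation by `G`. -/
structure IsInvariantBlock (ω : G →* Γ) (b : O[ω.ker]) : Prop extends IsBlock b where
  invariant : ∀ g : G,
    MonoidAlgebra.mapDomainAlgHom O O (MulAut.conjNormal g : MulAut ω.ker).toMonoidHom b = b

/-- The element `b` of `O N`, `N = ker ω`, as an element of `O G`. -/
def extend (ω : G →* Γ) (b : O[ω.ker]) : O[G] :=
  MonoidAlgebra.mapDomainAlgHom O O ω.ker.subtype b

variable {ω : G →* Γ} {b : O[ω.ker]}

lemma IsInvariantBlock.idem_extend (hb : IsInvariantBlock ω b) :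
    IsIdempotentElem (extend ω b) :=
  hb.idem.map (MonoidAlgebra.mapDomainAlgHom O O ω.ker.subtype)

/-- The algebra `A = O G b` (here written as `b O G b`; `b` is central in `O G`). -/
abbrev BlockAlg (hb : IsInvariantBlock ω b) : Type _ := hb.idem_extend.Corner

/-- The `Γ`-grading of `A = O G b`: the component `A_x` consists of the elements supported on
`ω⁻¹(x)`. -/
def blockGrading (hb : IsInvariantBlock ω b) (x : Γ) : Submodule O (BlockAlg hb) where
  carrier := {a | ∀ g : G, (cornerIncl (O := O) hb.idem_extend a).coeff g ≠ 0 → ω g = x}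
  zero_mem' := fun g hg => by simp at hg
  add_mem' := fun {a c} ha hc g hg => by
    by_cases h : (cornerIncl (O := O) hb.idem_extend a).coeff g = 0
    · refine hc g fun h' => hg ?_
      simp [h, h']
    · exact ha g h
  smul_mem' := fun r a ha g hg => ha g fun h => hg (by simp [h])

end Blocks

/-! ### Indecomposability, relative projectivity and vertices -/

section Vertices

variable {O : Type*} [CommRing O] {G M : Type*} [Group G] [AddCommGroup M] [Module O M]

/-- The `O G`-module `M` is indecomposable. -/
def IsIndecomposable (ρ : Representation O G M) : Prop :=
  Nontrivial ρ.asModule ∧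
    ∀ U V : Submodule O[G] ρ.asModule, IsCompl U V → U = ⊥ ∨ V = ⊥

/-- `M` is relatively `P`-projective: it is isomorphic to a direct summand of
`Ind_P^G (Res_P^G M)`. -/
def IsRelProjective (ρ : Representation O G M) (P : Subgroup G) : Prop :=
  ∃ (i : Representation.IntertwiningMap ρ (Representation.ind P.subtype (ρ.comp P.subtype)))
    (r : Representation.IntertwiningMap (Representation.ind P.subtype (ρ.comp P.subtype)) ρ),
    ∀ m, r (i m) = m

/-- `P` is a vertex of (the indecomposable `O G`-module) `M`: a minimal subgroup with respect to
which `M` is relatively projective. -/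
def IsVertex (ρ : Representation O G M) (P : Subgroup G) : Prop :=
  Minimal (IsRelProjective ρ) P

end Vertices

/-! ### Graded `O (G × G')`-modules -/

section GradedModules

variable {O : Type*} [CommRing O] {G G' Γ : Type*} [Group G] [Group G'] [Group Γ]
  {X : Type v} [AddCommGroup X] [Module O X]

/-- The subgroup `{(g, g') | ω g = ω' g'}` of `G × G'`. -/
def diag (ω : G →* Γ) (ω' : G' →* Γ) : Subgroup (G × G') where
  carrier := {q | ω q.1 = ω' q.2}
  one_mem' := by simp
  mul_mem' := fun {a c} (ha : ω a.1 = ω' a.2) (hc : ω c.1 = ω' c.2) => by simp [ha, hc]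
  inv_mem' := fun {a} (ha : ω a.1 = ω' a.2) => by simp [ha]

open Classical in
/-- `𝒳` makes the `O (G × G')`-module `X` a `Γ`-graded module. Viewing `X` as an
`(O G, O G')`-bimodule with `g m g' = (g, g'⁻¹) m`, this says `X = ⨁ₓ X_x` and
`g X_x g' ⊆ X_{ω(g) x ω'(g')}`. -/
structure IsGradedRep (ω : G →* Γ) (ω' : G' →* Γ) (ρ : Representation O (G × G') X)
    (𝒳 : Γ → Submodule O X) : Prop where
  internal : DirectSum.IsInternal 𝒳
  apply_mem : ∀ g g' x, ∀ m ∈ 𝒳 x, ρ (g, g') m ∈ 𝒳 (ω g * x * (ω' g')⁻¹)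

variable {ω : G →* Γ} {ω' : G' →* Γ} {ρ : Representation O (G × G') X} {𝒳 : Γ → Submodule O X}

/-- The `1`-component of a `Γ`-graded `O (G × G')`-module, as a module for the group
`{(g, g') | ω g = ω' g'}`. -/
def oneComponent (h : IsGradedRep ω ω' ρ 𝒳) : Representation O (diag ω ω') (𝒳 1) :=
  Subrepresentation.toRepresentation (ρ := ρ.comp (diag ω ω').subtype)
    { toSubmodule := 𝒳 1
      apply_mem_toSubmodule := fun q m hm => by
        have hq : ω q.1.1 = ω' q.1.2 := q.2
        simpa [hq] using h.apply_mem q.1.1 q.1.2 1 m hm }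

/-- The inclusion of `N × N'` into `{(g, g') | ω g = ω' g'}`, where `N = ker ω`,
`N' = ker ω'`. -/
def kerProd (ω : G →* Γ) (ω' : G' →* Γ) : ω.ker × ω'.ker →* diag ω ω' :=
  (ω.ker.subtype.prodMap ω'.ker.subtype).codRestrict (diag ω ω') (fun q => by
    change ω q.1 = ω' q.2
    rw [q.1.2, q.2.2])

/-- The left action of `O G` on an `O (G × G')`-module. -/
def leftHom (ρ : Representation O (G × G') X) : O[G] →ₐ[O] Module.End O X :=
  MonoidAlgebra.lift O (Module.End O X) G (ρ.comp (MonoidHom.inl G G'))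

/-- The right action of `O G'` on an `O (G × G')`-module: `m g' = (1, g'⁻¹) m`. -/
def rightHom (ρ : Representation O (G × G') X) : O[G'] →ₐ[O] (Module.End O X)ᵐᵒᵖ :=
  MonoidAlgebra.lift O (Module.End O X)ᵐᵒᵖ G'
    { toFun := fun g' => MulOpposite.op (ρ (1, g'⁻¹))
      map_one' := by simp [← Prod.one_eq_mk]
      map_mul' := fun g h => by
        rw [← MulOpposite.op_mul, ← map_mul, Prod.mk_mul_mk, one_mul, mul_inv_rev] }

lemma leftHom_rightHom_comm (ρ : Representation O (G × G') X) (a : O[G]) (c : O[G']) (m : X) :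
    leftHom ρ a ((rightHom ρ c).unop m) = (rightHom ρ c).unop (leftHom ρ a m) := by
  induction a using MonoidAlgebra.induction_linear with
  | zero => simp
  | add f g hf hg => simp [hf, hg]
  | single g r =>
    induction c using MonoidAlgebra.induction_linear with
    | zero => simp
    | add f g hf hg => simp [hf, hg]
    | single g' s =>
      have : ρ (g, 1) (ρ (1, g'⁻¹) m) = ρ (1, g'⁻¹) (ρ (g, 1) m) := by
        rw [← Module.End.mul_apply, ← Module.End.mul_apply, ← map_mul, ← map_mul]
        simp
      simp [leftHom, rightHom, this, smul_comm r s]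

/-- The `(A, A')`-bimodule, `A = O G b` and `A' = O G' b'`, given by an `O (G × G')`-module on
which `b` acts on the left, and `b'` on the right, as the identity. -/
def blockBimod {b : O[ω.ker]} {b' : O[ω'.ker]} (hb : IsInvariantBlock ω b)
    (hb' : IsInvariantBlock ω' b') (ρ : Representation O (G × G') X)
    (hl : leftHom ρ (extend ω b) = 1) (hr : rightHom ρ (extend ω' b') = 1) :
    AlgBimod O (BlockAlg hb) (BlockAlg hb') X where
  left := cornerRestrict hb.idem_extend (leftHom ρ) hl
  right := cornerRestrict hb'.idem_extend (rightHom ρ) hr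
  comm a c m := leftHom_rightHom_comm ρ a.1 c.1 m

/-- The standing assumptions on a `Γ`-graded `O (G × G')`-module `X` with respect to `G`-invariant
blocks: `X` is associated with `b` and `b'`, and its `1`-component `M` is finitely generated over
`O`, indecomposable over `O (N × N')`, and projective over both `O (N × 1)` and `O (1 × N')`.
(By the grading, `X` is induced from the `O {(g, g') | ω g = ω' g'}`-module `M`.) -/
structure IsBlockModule (ω : G →* Γ) (ω' : G' →* Γ) (b : O[ω.ker]) (b' : O[ω'.ker])
    (ρ : Representation O (G × G') X) (𝒳 : Γ → Submodule O X) : Prop where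
  block : IsInvariantBlock ω b
  block' : IsInvariantBlock ω' b'
  graded : IsGradedRep ω ω' ρ 𝒳
  left_one : leftHom ρ (extend ω b) = 1
  right_one : rightHom ρ (extend ω' b') = 1
  finite : Module.Finite O (𝒳 1)
  indecomposable : IsIndecomposable ((oneComponent graded).comp (kerProd ω ω'))
  projective_left : Module.Projective O[ω.ker]
    (Representation.asModule (G := ω.ker)
      ((oneComponent graded).comp ((kerProd ω ω').comp (MonoidHom.inl ω.ker ω'.ker))))
  projective_right : Module.Projective O[ω'.ker]
    (Representation.asModule (G := ω'.ker)
      ((oneComponent graded).comp ((kerProd ω ω').comp (MonoidHom.inr ω.ker ω'.ker))))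

/-- For a subgroup `P` of `{(g, g') | ω g = ω' g'}`, the surjective homomorphism from `P` onto its
projection in `G`. -/
def sigma (ω : G →* Γ) (ω' : G' →* Γ) (P : Subgroup (diag ω ω')) :
    P →* P.map ((MonoidHom.fst G G').comp (diag ω ω').subtype) :=
  ((MonoidHom.fst G G').comp (diag ω ω').subtype).subgroupMap P

/-- The `Γ`-graded `O (G × G')`-module `X` determines a basic graded Morita equivalence between
`O G b` and `O G' b'`: it induces a `Γ`-graded Morita equivalence, and for a vertex `P` of its
`1`-component the projection from `P` onto its image in `G` is an isomorphism. (Vertices exist and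
are conjugate, so the last condition does not depend on the choice of the vertex.) -/
structure DeterminesBasicGradedMorita (ω : G →* Γ) (ω' : G' →* Γ) (b : O[ω.ker])
    (b' : O[ω'.ker]) (ρ : Representation O (G × G') X) (𝒳 : Γ → Submodule O X) : Prop
    extends IsBlockModule ω ω' b b' ρ 𝒳 where
  morita : InducesGradedMorita (blockBimod block block' ρ left_one right_one)
    (blockGrading block) (blockGrading block') 𝒳
  basic : ∀ P : Subgroup (diag ω ω'), IsVertex (oneComponent graded) P →
    Function.Bijective (sigma ω ω' P)

/-! ### Truncation to a subgroup `Λ` of `Γ` -/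

/-- The identification of `ker ω` with the kernel of the restriction `ω⁻¹(Λ) → Λ` of `ω`. -/
def truncKer (ω : G →* Γ) (Λ : Subgroup Γ) : ω.ker →* (ω.subgroupComap Λ).ker where
  toFun n := ⟨⟨n.1, by
      rw [Subgroup.mem_comap, MonoidHom.mem_ker.mp n.2]
      exact Λ.one_mem⟩,
    Subtype.ext n.2⟩
  map_one' := rfl
  map_mul' _ _ := rfl

/-- The element `b` of `O N`, with `N` regarded as the kernel of `ω⁻¹(Λ) → Λ`. -/
def truncBlock (ω : G →* Γ) (Λ : Subgroup Γ) (b : O[ω.ker]) : O[(ω.subgroupComap Λ).ker] :=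
  MonoidAlgebra.mapDomainAlgHom O O (truncKer ω Λ) b

/-- `X_Λ = ⨁_{x ∈ Λ} X_x`, as an `O`-submodule of `X`. -/
def truncModule (𝒳 : Γ → Submodule O X) (Λ : Subgroup Γ) : Submodule O X :=
  ⨆ x : Λ, 𝒳 x

/-- The `Λ`-grading of `X_Λ`, with components `X_x` for `x ∈ Λ`. -/
def truncGrading (𝒳 : Γ → Submodule O X) (Λ : Subgroup Γ) (x : Λ) :
    Submodule O (truncModule 𝒳 Λ) :=
  (𝒳 x).submoduleOf (truncModule 𝒳 Λ)

/-- `X_Λ` as an `O (H × H')`-module, where `H = ω⁻¹(Λ)` and `H' = ω'⁻¹(Λ)`. -/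
def truncRep (h : IsGradedRep ω ω' ρ 𝒳) (Λ : Subgroup Γ) :
    Representation O (Λ.comap ω × Λ.comap ω') (truncModule 𝒳 Λ) :=
  Subrepresentation.toRepresentation
    (ρ := ρ.comp ((Λ.comap ω).subtype.prodMap (Λ.comap ω').subtype))
    { toSubmodule := truncModule 𝒳 Λ
      apply_mem_toSubmodule := fun q m hm => by
        have key : truncModule 𝒳 Λ ≤ (truncModule 𝒳 Λ).comap (ρ (q.1.1, q.2.1)) := by
          refine iSup_le fun x m hm => ?_
          exact (le_iSup (fun y : Λ => 𝒳 y)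
            ⟨_, Λ.mul_mem (Λ.mul_mem q.1.2 x.2) (Λ.inv_mem q.2.2)⟩)
            (h.apply_mem q.1.1 q.2.1 x m hm)
        exact key hm }

end GradedModules

end GradedMorita

end

/-! Truncation changes neither the `1`-component `M` nor the kernels `N` and `N'`. The conditions on
`M` over `N × N'` are therefore transported along evident isomorphisms, and two assertions have real
content.

Morita equivalence. Since `ω` and `ω'` are surjective and `b`, `b'` are central, `A` and `A'`
contain invertible homogeneous elements of every degree. If `Y` is the inverse bimodule of `X`, the
natural map from the tensor product of `X_Λ` and `Y_Λ` over `A'_Λ` to `X ⊗ Y` over `A'` is injective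
(`tensorTrunc_injective`) and carries each component of degree `z ∈ Λ` onto the component of degree
`z` (`map_tensorTrunc`). The given isomorphism `X ⊗ Y ≃ A` thus restricts to one onto `A_Λ`; the
other side is symmetric.

Vertices. The `1`-component of the truncation is the restriction of `M` to a subgroup of `diag ω
ω'`. If `P` is a vertex of the restriction and `Q` one of `M`, then `P` lies in a conjugate of `Q`
(`IsVertex.exists_conj_mem`). The projection to `G` is injective on `Q`, hence on its conjugates and
on `P`.

The containment rests on Higman's criterion (`isRelProjective_iff`), which writes the identity of
`M` as the sum of an equivariant family of endomorphisms indexed by cosets. Multiplying the families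
for `P` and `Q` gives a family indexed by pairs of cosets. Because `M` is indecomposable already
over `N × N'` and `O` is complete, endomorphisms commuting with the group behave as in a local ring,
so the sum over a single orbit of pairs is invertible. Then `M` is projective relative to the
stabilizer of a pair in that orbit, an intersection of conjugates of `P` and `Q`, and minimality of
`P` concludes. -/

noncomputable section

namespace GradedMorita

universe v

/-! ### Endomorphisms of indecomposable modules over a complete local ring -/

section LocalEndomorphisms

/-- A finitely generated module over a complete Noetherian local ring is complete. -/
lemma isAdicComplete_of_finite {O : Type*} [CommRing O] [IsNoetherianRing O] [IsLocalRing O]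
    [IsAdicComplete (IsLocalRing.maximalIdeal O) O] (M : Type*) [AddCommGroup M] [Module O M]
    [Module.Finite O M] : IsAdicComplete (IsLocalRing.maximalIdeal O) M := by
  have : IsPrecomplete (IsLocalRing.maximalIdeal O) M := by
    rw [← AdicCompletion.of_surjective_iff]
    -- The completion of the finite module `M` is a quotient of the tensor product of `M` with the
    -- completion of `O`, so images of `a ⊗ m` suffice; there `a` comes from `O` because `O` is
    -- complete.
    intro z
    obtain ⟨t, rfl⟩ := AdicCompletion.ofTensorProduct_surjective_of_finite
      (IsLocalRing.maximalIdeal O) M z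
    induction t with
    | zero => exact ⟨0, by simp⟩
    | add s t hs ht =>
      obtain ⟨x, hx⟩ := hs
      obtain ⟨y, hy⟩ := ht
      exact ⟨x + y, by simp [hx, hy]⟩
    | tmul a m =>
      obtain ⟨r, rfl⟩ := AdicCompletion.of_surjective (IsLocalRing.maximalIdeal O) O a
      refine ⟨r • m, ?_⟩
      rw [AdicCompletion.ofTensorProduct_tmul]
      rfl
  exact { }

/-- Idempotents lift modulo an ideal with respect to which the ring is Henselian. -/
lemma exists_idempotent_lift {R : Type*} [CommRing R] (I : Ideal R) [HenselianRing R I]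
    (a : R) (ha : a * a - a ∈ I) : ∃ e : R, IsIdempotentElem e ∧ e - a ∈ I := by
  obtain ⟨e, he, hea⟩ := HenselianRing.is_henselian (I := I)
    (Polynomial.X ^ 2 - Polynomial.X : Polynomial R)
    (by monicity!) a (by simpa [sq] using ha) (by
      -- The derivative `2a - 1` is its own inverse modulo `I`, as `(2a - 1)² = 4(a² - a) + 1`.
      refine IsUnit.of_mul_eq_one (Ideal.Quotient.mk I (2 * a - 1)) ?_
      rw [← map_mul, ← map_one (Ideal.Quotient.mk I), Ideal.Quotient.eq]
      have : (4 : R) * (a * a - a) ∈ I := I.mul_mem_left _ ha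
      convert this using 1
      simp
      ring)
  refine ⟨e, ?_, hea⟩
  simpa [sq, sub_eq_zero, Polynomial.IsRoot, IsIdempotentElem] using he

/-- A commutative finite algebra over a complete Noetherian local ring with only trivial
idempotents is local. -/
lemma isUnit_or_isUnit_one_sub_of_finite {O : Type*} [CommRing O] [IsNoetherianRing O]
    [IsLocalRing O] [IsAdicComplete (IsLocalRing.maximalIdeal O) O] {R : Type*} [CommRing R]
    [Algebra O R] [Module.Finite O R] (hR : ∀ e : R, IsIdempotentElem e → e = 0 ∨ e = 1) (s : R) :
    IsUnit s ∨ IsUnit (1 - s) := by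
  let I : Ideal R := (IsLocalRing.maximalIdeal O).map (algebraMap O R)
  have hO := isAdicComplete_of_finite (O := O) R
  have : IsAdicComplete I R :=
    { toIsHausdorff := IsHausdorff.map_algebraMap_iff.mpr inferInstance
      toIsPrecomplete := IsPrecomplete.map_algebraMap_iff.mpr inferInstance }
  have hI : I ≤ (⊥ : Ideal R).jacobson := IsAdicComplete.le_jacobson_bot I
  have : IsArtinianRing (R ⧸ I) := by
    let f : IsLocalRing.ResidueField O →+* R ⧸ I :=
      Ideal.quotientMap I (algebraMap O R) Ideal.le_comap_map
    algebraize [f]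
    have : IsScalarTower O (IsLocalRing.ResidueField O) (R ⧸ I) :=
      IsScalarTower.of_algebraMap_eq fun x => rfl
    have : Module.Finite (IsLocalRing.ResidueField O) (R ⧸ I) :=
      Module.Finite.of_restrictScalars_finite O _ _
    exact IsArtinianRing.of_finite (IsLocalRing.ResidueField O) _
  have hunit : ∀ x : R, IsUnit (Ideal.Quotient.mk I x) → IsUnit x := by
    intro x hx
    have := isLocalHom_of_le_jacobson_bot I hI
    exact hx.of_map
  -- Fitting's argument: the descending chain of powers of `s` stabilizes modulo `I`, so `s ^ n * c
  -- ^ n` is idempotent modulo `I`. It lifts to an idempotent `e`: if `e = 0`, then `s` is nilpotent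
  -- modulo `I`; if `e = 1`, it is invertible modulo `I`. Units lift because `I` lies in the
  -- Jacobson radical.
  obtain ⟨n, y, hy⟩ := IsArtinian.exists_pow_succ_smul_dvd (Ideal.Quotient.mk I s) (1 : R ⧸ I)
  obtain ⟨c, rfl⟩ := Ideal.Quotient.mk_surjective y
  have h1 : ∀ k, Ideal.Quotient.mk I (s ^ n) = Ideal.Quotient.mk I (s ^ (n + k) * c ^ k) := by
    intro k
    induction k with
    | zero => simp
    | succ k ih =>
      have : Ideal.Quotient.mk I (s ^ (n + 1) * c) = Ideal.Quotient.mk I (s ^ n) := by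
        simpa using hy
      rw [ih, show s ^ (n + (k + 1)) * c ^ (k + 1) = (s ^ (n + 1) * c) * (s ^ k * c ^ k) by ring,
        map_mul _ (s ^ (n + 1) * c), this, ← map_mul]
      ring_nf
  have h2 := h1 n
  obtain ⟨e, he, hea⟩ := exists_idempotent_lift I (s ^ n * c ^ n) (by
    rw [← Ideal.Quotient.eq, show s ^ n * c ^ n * (s ^ n * c ^ n) = (s ^ (n + n) * c ^ n) * c ^ n
      by ring, map_mul, ← h2, map_mul])
  rw [← Ideal.Quotient.eq] at hea
  rcases hR e he with rfl | rfl
  · right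
    refine hunit _ ?_
    rw [map_sub, map_one]
    refine IsNilpotent.isUnit_one_sub ⟨n, ?_⟩
    rw [← map_pow, h2, show s ^ (n + n) * c ^ n = (s ^ n * c ^ n) * s ^ n by ring, map_mul, ← hea]
    simp
  · left
    refine hunit _ ?_
    -- For `n = 0` the idempotent is `1` whatever `s` is, and invertibility has to be read off from
    -- `hy`.
    rcases Nat.eq_zero_or_pos n with rfl | hn
    · refine IsUnit.of_mul_eq_one (Ideal.Quotient.mk I c) ?_
      simpa using hy
    · refine IsUnit.of_mul_eq_one (Ideal.Quotient.mk I (s ^ (n - 1) * c ^ n)) ?_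
      rw [← map_mul, ← mul_assoc, ← pow_succ', Nat.sub_add_cancel hn, ← hea, map_one]

variable {O : Type*} [CommRing O] {G M : Type*} [Group G] [AddCommGroup M] [Module O M]

/-- Indecomposability in terms of idempotent endomorphisms. -/
lemma isIndecomposable_iff (ρ : Representation O G M) :
    IsIndecomposable ρ ↔ Nontrivial M ∧ ∀ f : Module.End O M, IsIdempotentElem f →
      (∀ g, Commute f (ρ g)) → f = 0 ∨ f = 1 := by
  refine and_congr Iff.rfl ⟨fun h f hf hfg => ?_, fun h U V hUV => ?_⟩
  · have hf' : ∀ (r : O[G]) (v : M), f (ρ.asAlgebraHom r v) = ρ.asAlgebraHom r (f v) := by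
      intro r v
      induction r using MonoidAlgebra.induction_linear with
      | zero => simp
      | add r s hr hs => simp [hr, hs]
      | single g r => simpa using congrArg (r • ·) (LinearMap.congr_fun (hfg g) v)
    let F : Module.End O[G] ρ.asModule :=
      { toFun := fun x => ρ.asModuleEquiv.symm (f (ρ.asModuleEquiv x))
        map_add' := fun x y => by simp
        map_smul' := fun r x => ρ.asModuleEquiv.injective (by
          simp [Representation.asModuleEquiv_map_smul, hf']) }
    have hF : IsIdempotentElem F := LinearMap.ext fun x => LinearMap.congr_fun hf x
    rcases h _ _ (LinearMap.IsIdempotentElem.isCompl hF) with h | h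
    · left
      rw [LinearMap.range_eq_bot] at h
      exact LinearMap.ext fun x => LinearMap.congr_fun h x
    · right
      rw [LinearMap.ker_eq_bot] at h
      refine LinearMap.ext fun x => h (LinearMap.congr_fun hF x)
  · let F : Module.End O[G] ρ.asModule := U.projection V hUV
    have hF : IsIdempotentElem F := Submodule.isIdempotentElem_projection hUV
    let f : Module.End O M :=
      ρ.asModuleEquiv.toLinearMap ∘ₗ F.restrictScalars O ∘ₗ ρ.asModuleEquiv.symm.toLinearMap
    have hf : IsIdempotentElem f := LinearMap.ext fun x =>
      LinearMap.congr_fun hF (ρ.asModuleEquiv.symm x)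
    have hfF : ∀ x, F x = ρ.asModuleEquiv.symm (f (ρ.asModuleEquiv x)) := fun x => rfl
    rcases h f hf (fun g => LinearMap.ext fun x => by
      have := F.map_smul (MonoidAlgebra.of O G g) (ρ.asModuleEquiv.symm x)
      rw [← Representation.asModuleEquiv_symm_map_rho, hfF, hfF,
        ← Representation.asModuleEquiv_symm_map_rho] at this
      exact this) with h | h
    · left
      rw [← Submodule.range_projection hUV, LinearMap.range_eq_bot]
      exact LinearMap.ext fun x => by simp [F, hfF, h]
    · right
      rw [← Submodule.ker_projection hUV, LinearMap.ker_eq_bot]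
      intro x y hxy
      simpa [F, hfF, h] using hxy

/-- Endomorphisms of an indecomposable finitely generated module over a complete Noetherian local
ring form a local ring. -/
lemma IsIndecomposable.isUnit_or_isUnit_one_sub [IsNoetherianRing O] [IsLocalRing O]
    [IsAdicComplete (IsLocalRing.maximalIdeal O) O] [Module.Finite O M]
    {ρ : Representation O G M} (h : IsIndecomposable ρ) (s : Module.End O M)
    (hs : ∀ g, Commute s (ρ g)) : IsUnit s ∨ IsUnit (1 - s) := by
  obtain ⟨-, h⟩ := (isIndecomposable_iff ρ).mp h
  -- The commutative algebra `O[s]` is finite over `O` and commutes with the action, so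
  -- indecomposability leaves it only trivial idempotents.
  let R := Algebra.adjoin O {s}
  have : IsNoetherian O (Module.End O M) := isNoetherian_of_isNoetherianRing_of_finite O _
  have : Module.Finite O R := inferInstanceAs (Module.Finite O (Subalgebra.toSubmodule R))
  have hcomm : ∀ a ∈ R, ∀ g, Commute a (ρ g) := fun a ha g => by
    have : R ≤ Subalgebra.centralizer O {ρ g} := Algebra.adjoin_le (by
      rintro _ rfl
      exact (Subalgebra.mem_centralizer_iff O).mpr fun _ hx => by
        rw [Set.mem_singleton_iff.mp hx]
        exact (hs g).symm.eq)
    simpa [Commute, SemiconjBy, eq_comm] using (Subalgebra.mem_centralizer_iff O).mp (this ha)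
  have key := isUnit_or_isUnit_one_sub_of_finite (O := O) (R := R) (fun e he => by
    rcases h e.1 (congrArg Subtype.val he) (hcomm e.1 e.2) with h | h
    · exact Or.inl (Subtype.ext h)
    · exact Or.inr (Subtype.ext h)) ⟨s, Algebra.self_mem_adjoin_singleton O s⟩
  exact key.imp (fun k => k.map R.val) (fun k => k.map R.val)

/-- If a finite sum of endomorphisms of an indecomposable module is invertible, then so is one of
them. -/
lemma IsIndecomposable.exists_isUnit_of_sum [IsNoetherianRing O] [IsLocalRing O]
    [IsAdicComplete (IsLocalRing.maximalIdeal O) O] [Module.Finite O M]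
    {ρ : Representation O G M} (h : IsIndecomposable ρ) {ι : Type*} (t : Finset ι)
    (s : ι → Module.End O M) (hs : ∀ i g, Commute (s i) (ρ g)) (hu : IsUnit (∑ i ∈ t, s i)) :
    ∃ i ∈ t, IsUnit (s i) := by
  classical
  have : Nontrivial M := h.1
  induction t using Finset.induction_on with
  | empty => simp at hu
  | insert i t hi ih =>
    obtain ⟨u, hu⟩ := hu
    have hug : ∀ g, Commute (↑u⁻¹ : Module.End O M) (ρ g) := fun g => by
      refine Commute.units_inv_left ?_
      rw [hu]
      exact Commute.sum_left _ _ _ fun j _ => hs j g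
    rcases h.isUnit_or_isUnit_one_sub (↑u⁻¹ * s i) (fun g => (hug g).mul_left (hs i g)) with h | h
    · exact ⟨i, by simp, by simpa using h⟩
    · have : (1 : Module.End O M) - ↑u⁻¹ * s i = ↑u⁻¹ * ∑ j ∈ t, s j := by
        rw [sub_eq_iff_eq_add, ← mul_add, add_comm, ← Finset.sum_insert hi, ← hu, Units.inv_mul]
      rw [this, Units.isUnit_units_mul] at h
      obtain ⟨j, hj, hju⟩ := ih h
      exact ⟨j, by simp [hj], hju⟩

end LocalEndomorphisms

/-! ### Higman's criterion -/

section Higman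

variable {O : Type*} [CommRing O] {G M : Type*} [Group G] [AddCommGroup M] [Module O M]

section Ind

open Representation

variable {H A B : Type*} [Group H] [AddCommGroup A] [Module O A] [AddCommGroup B] [Module O B]
  (φ : G →* H) (ρ : Representation O G A)

/-- A linear map out of an induced module, given on the generators `h ⊗ a`. -/
def indLift (Φ : H → A →ₗ[O] B) (hΦ : ∀ g h a, Φ (φ g * h) (ρ g a) = Φ h a) :
    IndV φ ρ →ₗ[O] B :=
  Coinvariants.lift _
    (TensorProduct.lift ((Finsupp.lift _ _ _ Φ) ∘ₗ
      (MonoidAlgebra.coeffLinearEquiv O).toLinearMap))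
    fun g => by
      ext h x
      simpa using hΦ g h x

lemma indLift_mk (Φ : H → A →ₗ[O] B) (hΦ : ∀ g h a, Φ (φ g * h) (ρ g a) = Φ h a) (h : H) (a : A) :
    indLift φ ρ Φ hΦ (IndV.mk φ ρ h a) = Φ h a := by
  simp [indLift]

lemma ind_mk_mul (g : G) (h : H) (a : A) :
    IndV.mk φ ρ (φ g * h) (ρ g a) = IndV.mk φ ρ h a := by
  have := Coinvariants.mk_self_apply (tprod ((leftRegular O H).comp φ) ρ) g
    ((MonoidAlgebra.single h (1 : O)) ⊗ₜ[O] a)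
  simpa using this

end Ind

/-- A family of endomorphisms indexed by a `G`-set is equivariant if it intertwines the action
of `G` with conjugation. -/
def IsEquivariantFamily (ρ : Representation O G M) {Ω : Type*} [MulAction G Ω]
    (F : Ω → Module.End O M) : Prop :=
  ∀ (g : G) (c : Ω), F (g • c) = ρ g * F c * ρ g⁻¹

/-- This plays the role of Mackey's formula: for coset families, the index set becomes pairs of
cosets under the diagonal action, whose stabilizers are intersections of conjugates. -/
lemma IsEquivariantFamily.mul {ρ : Representation O G M} {Ω Ω' : Type*} [MulAction G Ω]
    [MulAction G Ω'] {F : Ω → Module.End O M} {F' : Ω' → Module.End O M}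
    (hF : IsEquivariantFamily ρ F) (hF' : IsEquivariantFamily ρ F') :
    IsEquivariantFamily ρ fun w : Ω × Ω' => F w.1 * F' w.2 := by
  intro g w
  have : ρ g⁻¹ * ρ g = 1 := by rw [← map_mul, inv_mul_cancel, map_one]
  calc F (g • w.1) * F' (g • w.2) = ρ g * F w.1 * (ρ g⁻¹ * ρ g) * F' w.2 * ρ g⁻¹ := by
        rw [hF, hF']; simp only [mul_assoc]
    _ = _ := by rw [this]; simp only [mul_assoc, mul_one]

variable [Finite G]

/-- Higman's criterion for relative projectivity. -/
lemma isRelProjective_iff (ρ : Representation O G M) (P : Subgroup G) :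
    IsRelProjective ρ P ↔ ∃ F : G ⧸ P → Module.End O M, IsEquivariantFamily ρ F ∧
      ∑ᶠ c, F c = 1 := by
  classical
  have := Fintype.ofFinite (G ⧸ P)
  simp only [finsum_eq_sum_of_fintype]
  let σ := ρ.comp P.subtype
  let ι := Representation.IndV.mk P.subtype σ
  constructor
  · rintro ⟨i, r, hri⟩
    -- `E c` projects the induced module onto its summand belonging to one coset. The generators `h
    -- ⊗ a` are sorted by right cosets `P h`; the inverse turns these into the left cosets of `G ⧸
    -- P`.
    let E : G ⧸ P → Module.End O (Representation.IndV P.subtype σ) := fun c =>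
      indLift P.subtype σ (fun h => if ((h⁻¹ : G) : G ⧸ P) = c then ι h else 0) (by
        intro g h a
        have : (((P.subtype g * h)⁻¹ : G) : G ⧸ P) = ((h⁻¹ : G) : G ⧸ P) := by
          rw [QuotientGroup.eq]
          simp
        rw [this]
        split_ifs
        · exact ind_mk_mul P.subtype σ g h a
        · rfl)
    have hE : ∀ c h a, E c (ι h a) = if ((h⁻¹ : G) : G ⧸ P) = c then ι h a else 0 := by
      intro c h a
      rw [indLift_mk]
      split_ifs <;> rfl
    have hEsum : ∑ c, E c = 1 := by
      refine Representation.IndV.hom_ext _ _ fun h => LinearMap.ext fun a => ?_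
      change (∑ c, E c) (ι h a) = ι h a
      simp [LinearMap.sum_apply, hE]
    have hEeq : ∀ g c, E (g • c) * Representation.ind P.subtype σ g =
        Representation.ind P.subtype σ g * E c := by
      intro g c
      refine Representation.IndV.hom_ext _ _ fun h => LinearMap.ext fun a => ?_
      change E (g • c) (Representation.ind P.subtype σ g (ι h a)) =
        Representation.ind P.subtype σ g (E c (ι h a))
      rw [Representation.ind_mk, hE, hE]
      have : (((h * g⁻¹)⁻¹ : G) : G ⧸ P) = g • c ↔ ((h⁻¹ : G) : G ⧸ P) = c := by
        rw [mul_inv_rev, inv_inv, ← smul_eq_mul, ← MulAction.Quotient.smul_coe]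
        exact (MulAction.injective g).eq_iff
      simp only [this]
      split_ifs
      · rw [Representation.ind_mk]
      · simp
    refine ⟨fun c => r.toLinearMap ∘ₗ E c ∘ₗ i.toLinearMap, fun g c => LinearMap.ext fun m => ?_, ?_⟩
    · have h1 := LinearMap.congr_fun (hEeq g c) (i (ρ g⁻¹ m))
      simp only [Module.End.mul_apply] at h1
      have h2 : Representation.ind P.subtype σ g (i (ρ g⁻¹ m)) = i m := by
        rw [← i.isIntertwining]
        simp
      change r (E (g • c) (i m)) = ρ g (r (E c (i (ρ g⁻¹ m))))
      rw [← r.isIntertwining, ← h1, h2]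
    · refine LinearMap.ext fun m => ?_
      have := LinearMap.congr_fun hEsum (i m)
      rw [LinearMap.sum_apply] at this ⊢
      change ∑ c, r (E c (i m)) = m
      rw [← map_sum, this]
      exact hri m
  · rintro ⟨F, hF, hF1⟩
    -- Equivariance determines `F` by its value `f` at the trivial coset, and `∑ F = 1` says that
    -- the relative trace of `f` is `1`. The splitting is `i m = ∑ g⁻¹ ⊗ f (g⁻¹ m)` over coset
    -- representatives, with `r (h ⊗ m) = h⁻¹ m`.
    let f := F ((1 : G) : G ⧸ P)
    have hf : ∀ p : P, ρ p * f = f * ρ p := by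
      intro p
      have h1 := hF p ((1 : G) : G ⧸ P)
      have h2 : (p : G) • ((1 : G) : G ⧸ P) = ((1 : G) : G ⧸ P) := by
        rw [MulAction.Quotient.smul_coe, QuotientGroup.eq]
        simp
      rw [h2] at h1
      change f = ρ p * f * ρ (p : G)⁻¹ at h1
      conv_rhs => rw [h1]
      rw [mul_assoc, ← map_mul, inv_mul_cancel, map_one, mul_one]
    have hFg : ∀ g : G, F (g : G ⧸ P) = ρ g * f * ρ g⁻¹ := by
      intro g
      rw [← hF g, MulAction.Quotient.smul_coe, smul_eq_mul, mul_one]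
    let Φ : G ⧸ P → M →ₗ[O] Representation.IndV P.subtype σ := fun c =>
      Quotient.liftOn' c (fun g => ι g⁻¹ ∘ₗ f ∘ₗ ρ g⁻¹) (by
        intro g h hgh
        rw [QuotientGroup.leftRel_apply] at hgh
        refine LinearMap.ext fun m => ?_
        have h1 : h⁻¹ = P.subtype ⟨g⁻¹ * h, hgh⟩⁻¹ * g⁻¹ := by simp
        have h2 : f (ρ h⁻¹ m) = σ ⟨g⁻¹ * h, hgh⟩⁻¹ (f (ρ g⁻¹ m)) := by
          have := LinearMap.congr_fun (hf ⟨g⁻¹ * h, hgh⟩⁻¹) (ρ g⁻¹ m)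
          refine Eq.trans ?_ this.symm
          conv_lhs => rw [h1, map_mul]
          rfl
        change ι g⁻¹ (f (ρ g⁻¹ m)) = ι h⁻¹ (f (ρ h⁻¹ m))
        rw [h2, h1]
        exact (ind_mk_mul P.subtype σ _ _ _).symm)
    have hΦ : ∀ (g : G) m, Φ (g : G ⧸ P) m = ι g⁻¹ (f (ρ g⁻¹ m)) := fun g m => rfl
    have hΦeq : ∀ (g : G) c m, Φ (g • c) (ρ g m) = Representation.ind P.subtype σ g (Φ c m) := by
      intro g c m
      obtain ⟨h, rfl⟩ := QuotientGroup.mk_surjective c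
      rw [MulAction.Quotient.smul_coe, hΦ, hΦ, Representation.ind_mk, smul_eq_mul, mul_inv_rev,
        map_mul]
      simp [ι]
    let i : M →ₗ[O] Representation.IndV P.subtype σ := ∑ c, Φ c
    let r : Representation.IndV P.subtype σ →ₗ[O] M :=
      indLift P.subtype σ (fun h => ρ h⁻¹) (fun p h m => by
        change ρ ((p : G) * h)⁻¹ (ρ p m) = ρ h⁻¹ m
        rw [← Module.End.mul_apply, ← map_mul]
        simp)
    have hr : ∀ h m, r (ι h m) = ρ h⁻¹ m := fun h m => indLift_mk _ _ _ _ h m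
    refine ⟨i.intertwiningMap_of_isIntertwiningMap _ _ fun g m => ?_,
      r.intertwiningMap_of_isIntertwiningMap _ _ fun g x => ?_, fun m => ?_⟩
    · simp only [i, LinearMap.sum_apply, map_sum]
      rw [← Equiv.sum_comp (MulAction.toPerm g : Equiv.Perm (G ⧸ P))]
      exact Finset.sum_congr rfl fun c _ => hΦeq g c m
    · have : r ∘ₗ Representation.ind P.subtype σ g = ρ g ∘ₗ r := by
        refine Representation.IndV.hom_ext _ _ fun h => LinearMap.ext fun a => ?_
        change r (Representation.ind P.subtype σ g (ι h a)) = ρ g (r (ι h a))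
        rw [Representation.ind_mk, hr, hr]
        simp
      exact LinearMap.congr_fun this x
    · change r (i m) = m
      simp only [i, LinearMap.sum_apply, map_sum]
      have h1 := LinearMap.congr_fun hF1 m
      rw [LinearMap.sum_apply] at h1
      refine Eq.trans (Finset.sum_congr rfl fun c _ => ?_) h1
      obtain ⟨g, rfl⟩ := QuotientGroup.mk_surjective c
      rw [hΦ, hr, hFg]
      simp

/-- Relative projectivity is invariant under isomorphism. -/
lemma IsRelProjective.of_equiv {M' : Type*} [AddCommGroup M'] [Module O M']
    {ρ : Representation O G M} {ρ' : Representation O G M'} {P : Subgroup G}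
    (h : IsRelProjective ρ P) (e : M ≃ₗ[O] M') (he : ∀ g m, e (ρ g m) = ρ' g (e m)) :
    IsRelProjective ρ' P := by
  rw [isRelProjective_iff] at h ⊢
  obtain ⟨F, hF, hF1⟩ := h
  have := Fintype.ofFinite (G ⧸ P)
  refine ⟨fun c => e.conj (F c), fun g c => ?_, ?_⟩
  · have hg : ∀ g, ρ' g = e.conj (ρ g) := fun g => LinearMap.ext fun m => by
      simp [LinearEquiv.conj_apply, he]
    change e.conj (F (g • c)) = _
    rw [hF, hg, hg, Module.End.mul_eq_comp, Module.End.mul_eq_comp, LinearEquiv.conj_comp,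
      LinearEquiv.conj_comp]
    rfl
  · rw [finsum_eq_sum_of_fintype] at hF1 ⊢
    rw [← map_sum, hF1, Module.End.one_eq_id, LinearEquiv.conj_id]
    rfl

lemma IsVertex.of_equiv {M' : Type*} [AddCommGroup M'] [Module O M']
    {ρ : Representation O G M} {ρ' : Representation O G M'} {P : Subgroup G}
    (h : IsVertex ρ P) (e : M ≃ₗ[O] M') (he : ∀ g m, e (ρ g m) = ρ' g (e m)) :
    IsVertex ρ' P := by
  refine ⟨h.1.of_equiv e he, fun Q hQ hQP => h.2 (hQ.of_equiv e.symm fun g m => ?_) hQP⟩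
  rw [e.symm_apply_eq, he, e.apply_symm_apply]

lemma isRelProjective_top (ρ : Representation O G M) : IsRelProjective ρ ⊤ := by
  rw [isRelProjective_iff]
  refine ⟨fun _ => 1, fun g c => ?_, ?_⟩
  · rw [mul_one, ← map_mul, mul_inv_cancel, map_one]
  · have := Fintype.ofFinite (G ⧸ (⊤ : Subgroup G))
    have := QuotientGroup.subsingleton_quotient_top (G := G)
    rw [finsum_eq_sum_of_fintype, Fintype.sum_subsingleton _ ((1 : G) : G ⧸ (⊤ : Subgroup G))]

lemma exists_isVertex (ρ : Representation O G M) : ∃ P, IsVertex ρ P := by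
  obtain ⟨P, -, hP⟩ := (Set.toFinite {P | IsRelProjective ρ P}).exists_le_minimal
    (isRelProjective_top ρ)
  exact ⟨P, hP⟩

end Higman

/-! ### Vertices of restricted modules -/

section Restriction

variable {O : Type*} [CommRing O] [IsNoetherianRing O] [IsLocalRing O]
  [IsAdicComplete (IsLocalRing.maximalIdeal O) O] {G H K M : Type*} [Group G] [Finite G]
  [Group H] [Finite H] [Group K] [AddCommGroup M] [Module O M] [Module.Finite O M]

/-- If the sum of an equivariant family is `1`, then the module is projective relative to the
stabilizer of some element of the index set. -/
lemma exists_isRelProjective_stabilizer {ρ : Representation O H M} {k : K →* H}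
    (hρ : IsIndecomposable (ρ.comp k)) {Ω : Type*} [Finite Ω] [MulAction H Ω]
    {F : Ω → Module.End O M} (hF : IsEquivariantFamily ρ F) (hF1 : ∑ᶠ w, F w = 1) :
    ∃ w : Ω, ∀ h : H, IsRelProjective ρ (MulAction.stabilizer H (h • w)) := by
  classical
  have := Fintype.ofFinite Ω
  have := Fintype.ofFinite (MulAction.orbitRel.Quotient H Ω)
  -- Sums over orbits commute with all of `H`, unlike single members of the family, so locality
  -- applies to them.
  let s : MulAction.orbitRel.Quotient H Ω → Module.End O M := fun o =>
    ∑ w with (⟦w⟧ : MulAction.orbitRel.Quotient H Ω) = o, F w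
  have hmk : ∀ (h : H) (w : Ω), (⟦h • w⟧ : MulAction.orbitRel.Quotient H Ω) = ⟦w⟧ := fun h w =>
    Quotient.sound (MulAction.mem_orbit w h)
  have hs : ∀ o h, Commute (s o) (ρ h) := by
    intro o h
    change s o * ρ h = ρ h * s o
    simp only [s, Finset.sum_mul, Finset.mul_sum]
    refine Finset.sum_bij' (fun w _ => h⁻¹ • w) (fun w _ => h • w) ?_ ?_ ?_ ?_ ?_
    · simp [hmk]
    · simp [hmk]
    · simp
    · simp
    · intro w _
      rw [hF, inv_inv, ← mul_assoc, ← mul_assoc, ← map_mul, mul_inv_cancel, map_one, one_mul]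
  have hsum : ∑ o, s o = 1 := by
    rw [finsum_eq_sum_of_fintype] at hF1
    rw [← hF1, Finset.sum_fiberwise]
  obtain ⟨o, -, u, hu⟩ := hρ.exists_isUnit_of_sum Finset.univ s (fun o g => hs o (k g))
    (by rw [hsum]; exact isUnit_one)
  have huh : ∀ h, Commute (↑u⁻¹ : Module.End O M) (ρ h) := fun h =>
    Commute.units_inv_left (by rw [hu]; exact hs o h)
  obtain ⟨w, rfl⟩ := Quotient.exists_rep o
  refine ⟨w, fun h => ?_⟩
  rw [isRelProjective_iff]
  have := Fintype.ofFinite (H ⧸ MulAction.stabilizer H (h • w))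
  -- The orbit is identified with the cosets of a stabilizer. Its sum is the unit `u`, and dividing
  -- by `u` preserves equivariance because `u` commutes with `H`.
  refine ⟨fun c => F (MulAction.ofQuotientStabilizer H (h • w) c) * ↑u⁻¹, fun g c => ?_, ?_⟩
  · dsimp only
    rw [MulAction.ofQuotientStabilizer_smul, hF, mul_assoc, ← (huh g⁻¹).eq, ← mul_assoc,
      ← mul_assoc]
  · rw [finsum_eq_sum_of_fintype, ← Finset.sum_mul]
    suffices h : ∑ c, F (MulAction.ofQuotientStabilizer H (h • w) c) = s ⟦w⟧ by
      rw [h, ← hu, Units.mul_inv]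
    refine Finset.sum_bij (fun c _ => MulAction.ofQuotientStabilizer H (h • w) c) ?_ ?_ ?_ ?_
    · intro c _
      obtain ⟨g, rfl⟩ := QuotientGroup.mk_surjective c
      rw [MulAction.ofQuotientStabilizer_mk]
      simp [hmk]
    · intro c _ d _ hcd
      exact MulAction.injective_ofQuotientStabilizer H _ hcd
    · intro v hv
      have hv : (⟦v⟧ : MulAction.orbitRel.Quotient H Ω) = ⟦w⟧ := by simpa using hv
      obtain ⟨g, hg⟩ := Quotient.exact hv
      refine ⟨((g * h⁻¹ : H) : H ⧸ MulAction.stabilizer H (h • w)), Finset.mem_univ _, ?_⟩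
      rw [MulAction.ofQuotientStabilizer_mk, smul_smul, inv_mul_cancel_right]
      exact hg
    · intro _ _
      rfl

/-- A vertex of the restriction of a module is contained in a conjugate of any subgroup with
respect to which the module is relatively projective, provided that the restriction stays
indecomposable over a smaller group. -/
lemma IsVertex.exists_conj_mem {ρ : Representation O G M} {j : H →* G} {k : K →* H}
    (hρ : IsIndecomposable ((ρ.comp j).comp k)) {P : Subgroup H} (hP : IsVertex (ρ.comp j) P)
    {Q : Subgroup G} (hQ : IsRelProjective ρ Q) : ∃ g : G, ∀ x ∈ P, g⁻¹ * j x * g ∈ Q := by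
  obtain ⟨F, hF, hF1⟩ := (isRelProjective_iff _ _).mp hP.1
  obtain ⟨F', hF', hF1'⟩ := (isRelProjective_iff _ _).mp hQ
  let _ : MulAction H (G ⧸ Q) := MulAction.compHom (G ⧸ Q) j
  have hF'j : IsEquivariantFamily (ρ.comp j) F' := fun h c => (hF' (j h) c).trans <| by
    simp
  have hsum : ∑ᶠ w : (H ⧸ P) × (G ⧸ Q), F w.1 * F' w.2 = 1 := by
    have := Fintype.ofFinite (H ⧸ P)
    have := Fintype.ofFinite (G ⧸ Q)
    rw [finsum_eq_sum_of_fintype] at hF1 hF1' ⊢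
    rw [Fintype.sum_prod_type, ← Fintype.sum_mul_sum, hF1, hF1', one_mul]
  obtain ⟨w, hw⟩ := exists_isRelProjective_stabilizer hρ (hF.mul hF'j) hsum
  obtain ⟨c, d⟩ := w
  obtain ⟨h, rfl⟩ := QuotientGroup.mk_surjective c
  obtain ⟨g, hg⟩ := QuotientGroup.mk_surjective (h⁻¹ • d)
  -- Translating by `h⁻¹` moves the first coset to the trivial one. The stabilizer of the pair is
  -- then contained in `P`, so it equals `P` by minimality; the second coset gives the conjugate of
  -- `Q`.
  have hstab := hw h⁻¹
  have hle : P ≤ MulAction.stabilizer H (h⁻¹ • ((h : H ⧸ P), d)) := by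
    refine hP.2 hstab fun x hx => ?_
    have hx1 := congrArg Prod.fst (MulAction.mem_stabilizer_iff.mp hx)
    change x • h⁻¹ • (h : H ⧸ P) = h⁻¹ • (h : H ⧸ P) at hx1
    rw [MulAction.Quotient.smul_coe, MulAction.Quotient.smul_coe, QuotientGroup.eq] at hx1
    simpa using hx1
  refine ⟨g, fun x hx => ?_⟩
  have hx2 := congrArg Prod.snd (MulAction.mem_stabilizer_iff.mp (hle hx))
  change j x • (h⁻¹ • d) = h⁻¹ • d at hx2
  rw [← hg, MulAction.Quotient.smul_coe, eq_comm, QuotientGroup.eq] at hx2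
  simpa [mul_assoc] using hx2

end Restriction

/-! ### Truncation of graded modules -/

section TruncModule

variable {O : Type*} [CommRing O] {Γ : Type*} [Group Γ] {X Y Z : Type*} [AddCommGroup X]
  [Module O X] [AddCommGroup Y] [Module O Y] [AddCommGroup Z] [Module O Z]

lemma linearMap_ext_of_iSup {ι : Type*} {𝒳 : ι → Submodule O X} (h : ⨆ z, 𝒳 z = ⊤)
    {f g : X →ₗ[O] Y} (hfg : ∀ z, ∀ x ∈ 𝒳 z, f x = g x) : f = g := by
  rw [← LinearMap.eqLocus_eq_top, eq_top_iff, ← h]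
  exact iSup_le hfg

lemma linearMap_ext₂_of_iSup {ι κ : Type*} {𝒳 : ι → Submodule O X} {𝒴 : κ → Submodule O Y}
    (h : ⨆ z, 𝒳 z = ⊤) (h' : ⨆ z, 𝒴 z = ⊤) {f g : X →ₗ[O] Y →ₗ[O] Z}
    (hfg : ∀ z, ∀ x ∈ 𝒳 z, ∀ w, ∀ y ∈ 𝒴 w, f x y = g x y) : f = g :=
  linearMap_ext_of_iSup h fun z x hx => linearMap_ext_of_iSup h' (hfg z x hx)

variable {𝒳 : Γ → Submodule O X} {Λ : Subgroup Γ}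

lemma le_truncModule {z : Γ} (hz : z ∈ Λ) : 𝒳 z ≤ truncModule 𝒳 Λ :=
  le_iSup (fun x : Λ => 𝒳 x) ⟨z, hz⟩

lemma map_truncGrading (z : Λ) :
    (truncGrading 𝒳 Λ z).map (truncModule 𝒳 Λ).subtype = 𝒳 z := by
  rw [truncGrading, Submodule.submoduleOf, Submodule.map_comap_subtype]
  exact inf_eq_right.mpr (le_truncModule z.2)

lemma truncGrading_iSup : ⨆ z, truncGrading 𝒳 Λ z = ⊤ := by
  refine Submodule.map_injective_of_injective (truncModule 𝒳 Λ).injective_subtype ?_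
  rw [Submodule.map_iSup, Submodule.map_subtype_top]
  simp only [map_truncGrading]
  rfl

lemma truncGrading_isInternal {_ : DecidableEq Γ} {_ : DecidableEq Λ}
    (h : DirectSum.IsInternal 𝒳) :
    DirectSum.IsInternal (truncGrading 𝒳 Λ) := by
  rw [DirectSum.isInternal_submodule_iff_iSupIndep_and_iSup_eq_top]
  refine ⟨?_, truncGrading_iSup⟩
  have h1 : iSupIndep fun z : Λ => 𝒳 z := h.submodule_iSupIndep.comp Subtype.val_injective
  -- Submodules of `X_Λ` form the interval below `X_Λ` in the lattice of submodules of `X`, where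
  -- independence is inherited from `𝒳`.
  have h2 : (truncModule 𝒳 Λ).mapIic ∘ truncGrading 𝒳 Λ =
      fun z : Λ => ⟨𝒳 z, le_truncModule z.2⟩ :=
    funext fun z => Subtype.ext (map_truncGrading z)
  rw [← iSupIndep_map_orderIso_iff (truncModule 𝒳 Λ).mapIic, h2]
  exact .of_coe_Iic_comp h1

open Classical in
/-- The projection of a graded module onto its truncation. -/
def truncProj (h : DirectSum.IsInternal 𝒳) (Λ : Subgroup Γ) : X →ₗ[O] truncModule 𝒳 Λ :=
  DirectSum.toModule O Γ _
    (fun z => if hz : z ∈ Λ then Submodule.inclusion (le_truncModule hz) else 0) ∘ₗ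
    (LinearEquiv.ofBijective (DirectSum.coeLinearMap 𝒳) h).symm.toLinearMap

open Classical in
lemma truncProj_coe (h : DirectSum.IsInternal 𝒳) {z : Γ} (x : 𝒳 z) :
    truncProj h Λ x = if hz : z ∈ Λ then Submodule.inclusion (le_truncModule hz) x else 0 := by
  have : (LinearEquiv.ofBijective (DirectSum.coeLinearMap 𝒳) h).symm (x : X) =
      DirectSum.lof O Γ (fun z => 𝒳 z) z x := by
    rw [LinearEquiv.symm_apply_eq]
    exact (DirectSum.coeLinearMap_lof 𝒳 z x).symm
  simp only [truncProj, LinearMap.comp_apply, LinearEquiv.coe_coe, this, DirectSum.toModule_lof]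
  split_ifs <;> rfl

open Classical in
lemma truncProj_of_notMem (h : DirectSum.IsInternal 𝒳) {z : Γ} (hz : z ∉ Λ) {x : X} (hx : x ∈ 𝒳 z) :
    truncProj h Λ x = 0 := by
  rw [truncProj_coe h ⟨x, hx⟩, dif_neg hz]

open Classical in
lemma truncProj_subtype (h : DirectSum.IsInternal 𝒳) (x : truncModule 𝒳 Λ) :
    truncProj h Λ x = x := by
  suffices h : truncProj h Λ ∘ₗ (truncModule 𝒳 Λ).subtype = LinearMap.id from
    LinearMap.congr_fun h x
  refine linearMap_ext_of_iSup truncGrading_iSup fun z x hx => ?_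
  change truncProj h Λ (⟨x.1, hx⟩ : 𝒳 z).1 = x
  rw [truncProj_coe h, dif_pos z.2]
  rfl

end TruncModule

/-! ### Truncation of graded Morita equivalences -/

section TruncMorita

variable {O : Type*} [CommRing O] {Γ : Type*} [Group Γ] {A B C A₀ B₀ C₀ : Type*} [Ring A]
  [Algebra O A] [Ring B] [Algebra O B] [Ring C] [Algebra O C] [Ring A₀] [Algebra O A₀] [Ring B₀]
  [Algebra O B₀] [Ring C₀] [Algebra O C₀] {X Y : Type*} [AddCommGroup X] [Module O X]
  [AddCommGroup Y] [Module O Y] {𝒜 : Γ → Submodule O A} {ℬ : Γ → Submodule O B}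
  {𝒞 : Γ → Submodule O C} {Λ : Subgroup Γ} {𝒜₀ : Λ → Submodule O A₀} {ℬ₀ : Λ → Submodule O B₀}
  {𝒞₀ : Λ → Submodule O C₀} {𝒳 : Γ → Submodule O X} {𝒴 : Γ → Submodule O Y}

/-- The `Γ`-graded algebra `A` has an invertible homogeneous element in each degree, and `f`
identifies the `Λ`-graded algebra `A₀` with `⨁ₓ A_x`, where `x` runs through `Λ`. -/
structure IsTruncAlg (𝒜 : Γ → Submodule O A) (𝒜₀ : Λ → Submodule O A₀) (f : A₀ →ₐ[O] A) :
    Prop where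
  injective : Function.Injective f
  mem_iff : ∀ (x : Λ) (a : A₀), a ∈ 𝒜₀ x ↔ f a ∈ 𝒜 x
  exists_eq : ∀ x ∈ Λ, ∀ a ∈ 𝒜 x, ∃ a₀, f a₀ = a
  iSup_eq_top : ⨆ x, 𝒜 x = ⊤
  iSup_eq_top' : ⨆ x, 𝒜₀ x = ⊤
  mul_mem : ∀ x y, ∀ a ∈ 𝒜 x, ∀ c ∈ 𝒜 y, a * c ∈ 𝒜 (x * y)
  exists_unit : ∀ x, ∃ u ∈ 𝒜 x, ∃ v ∈ 𝒜 x⁻¹, u * v = 1 ∧ v * u = 1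

namespace AlgBimod

/-- The right action as a linear map. -/
def rightLinear (β : AlgBimod O A B X) : B →ₗ[O] Module.End O X :=
  (MulOpposite.opLinearEquiv O).symm.toLinearMap ∘ₗ β.right.toLinearMap

lemma rightLinear_apply (β : AlgBimod O A B X) (b : B) : β.rightLinear b = (β.right b).unop := rfl

lemma rightLinear_mul (β : AlgBimod O A B X) (b c : B) (x : X) :
    β.rightLinear (b * c) x = β.rightLinear c (β.rightLinear b x) := by
  simp [rightLinear_apply]

lemma rightLinear_one (β : AlgBimod O A B X) (x : X) : β.rightLinear 1 x = x := by
  simp [rightLinear_apply]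

/-- The `Λ`-graded bimodule structure on the truncation of a `Γ`-graded bimodule. -/
structure IsTrunc (β₀ : AlgBimod O A₀ B₀ (truncModule 𝒳 Λ)) (β : AlgBimod O A B X)
    (f : A₀ →ₐ[O] A) (g : B₀ →ₐ[O] B) : Prop where
  left : ∀ a x, (β₀.left a x : X) = β.left (f a) x
  right : ∀ b x, (β₀.rightLinear b x : X) = β.rightLinear (g b) x

lemma IsGraded.left_mem_truncModule {β : AlgBimod O A B X} (hβ : β.IsGraded 𝒜 ℬ 𝒳)
    {f : A₀ →ₐ[O] A} (hf : IsTruncAlg 𝒜 𝒜₀ f) (a : A₀) :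
    truncModule 𝒳 Λ ≤ (truncModule 𝒳 Λ).comap (β.left (f a)) := by
  intro x hx
  -- Stability amounts to the vanishing of a bilinear map into `X / X_Λ`, which can be tested on
  -- homogeneous elements.
  let F : A₀ →ₗ[O] truncModule 𝒳 Λ →ₗ[O] X ⧸ truncModule 𝒳 Λ :=
    (LinearMap.llcomp O _ _ _ (truncModule 𝒳 Λ).mkQ) ∘ₗ
      (LinearMap.lcomp O X (truncModule 𝒳 Λ).subtype) ∘ₗ β.left.toLinearMap ∘ₗ f.toLinearMap
  have hF : F = 0 := by
    refine linearMap_ext₂_of_iSup hf.iSup_eq_top' truncGrading_iSup fun z a ha w x hx => ?_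
    refine (Submodule.Quotient.mk_eq_zero _).mpr ?_
    exact le_truncModule (Λ.mul_mem z.2 w.2)
      (hβ.left_mem z w (f a) ((hf.mem_iff z a).mp ha) x hx)
  exact (Submodule.Quotient.mk_eq_zero (truncModule 𝒳 Λ)).mp
    (LinearMap.congr_fun (LinearMap.congr_fun hF a) ⟨x, hx⟩)

lemma IsGraded.right_mem_truncModule {β : AlgBimod O A B X} (hβ : β.IsGraded 𝒜 ℬ 𝒳)
    {f : B₀ →ₐ[O] B} (hf : IsTruncAlg ℬ ℬ₀ f) (b : B₀) :
    truncModule 𝒳 Λ ≤ (truncModule 𝒳 Λ).comap (β.rightLinear (f b)) := by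
  intro x hx
  let F : B₀ →ₗ[O] truncModule 𝒳 Λ →ₗ[O] X ⧸ truncModule 𝒳 Λ :=
    (LinearMap.llcomp O _ _ _ (truncModule 𝒳 Λ).mkQ) ∘ₗ
      (LinearMap.lcomp O X (truncModule 𝒳 Λ).subtype) ∘ₗ β.rightLinear ∘ₗ f.toLinearMap
  have hF : F = 0 := by
    refine linearMap_ext₂_of_iSup hf.iSup_eq_top' truncGrading_iSup fun z b hb w x hx => ?_
    refine (Submodule.Quotient.mk_eq_zero _).mpr ?_
    exact le_truncModule (Λ.mul_mem w.2 z.2)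
      (hβ.right_mem w z x hx (f b) ((hf.mem_iff z b).mp hb))
  exact (Submodule.Quotient.mk_eq_zero (truncModule 𝒳 Λ)).mp
    (LinearMap.congr_fun (LinearMap.congr_fun hF b) ⟨x, hx⟩)

/-- The truncation of a graded bimodule. -/
def trunc {β : AlgBimod O A B X} (hβ : β.IsGraded 𝒜 ℬ 𝒳) {f : A₀ →ₐ[O] A}
    (hf : IsTruncAlg 𝒜 𝒜₀ f) {g : B₀ →ₐ[O] B} (hg : IsTruncAlg ℬ ℬ₀ g) :
    AlgBimod O A₀ B₀ (truncModule 𝒳 Λ) where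
  left := AlgHom.ofLinearMap
    { toFun := fun a => (β.left (f a)).restrict (hβ.left_mem_truncModule hf a)
      map_add' := fun a a' => LinearMap.ext fun x => Subtype.ext (by simp)
      map_smul' := fun r a => LinearMap.ext fun x => Subtype.ext (by simp) }
    (LinearMap.ext fun x => Subtype.ext (by simp))
    (fun a a' => LinearMap.ext fun x => Subtype.ext (by simp))
  right := AlgHom.ofLinearMap
    { toFun := fun b => MulOpposite.op
        ((β.rightLinear (g b)).restrict (hβ.right_mem_truncModule hg b))
      map_add' := fun a a' => MulOpposite.unop_injective <|
        LinearMap.ext fun x => Subtype.ext (by simp)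
      map_smul' := fun r a => MulOpposite.unop_injective <|
        LinearMap.ext fun x => Subtype.ext (by simp) }
    (MulOpposite.unop_injective <| LinearMap.ext fun x => Subtype.ext (by simp [rightLinear_one]))
    (fun a a' => MulOpposite.unop_injective <|
      LinearMap.ext fun x => Subtype.ext (by simp [rightLinear_mul]))
  comm a b x := Subtype.ext (β.comm (f a) (g b) x)

lemma trunc_isTrunc {β : AlgBimod O A B X} (hβ : β.IsGraded 𝒜 ℬ 𝒳) {f : A₀ →ₐ[O] A}
    (hf : IsTruncAlg 𝒜 𝒜₀ f) {g : B₀ →ₐ[O] B} (hg : IsTruncAlg ℬ ℬ₀ g) :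
    (trunc hβ hf hg).IsTrunc β f g :=
  ⟨fun _ _ => rfl, fun _ _ => rfl⟩

lemma IsTrunc.isGraded {β₀ : AlgBimod O A₀ B₀ (truncModule 𝒳 Λ)} {β : AlgBimod O A B X}
    {f : A₀ →ₐ[O] A} {g : B₀ →ₐ[O] B} (h : β₀.IsTrunc β f g) (hβ : β.IsGraded 𝒜 ℬ 𝒳)
    (hf : IsTruncAlg 𝒜 𝒜₀ f) (hg : IsTruncAlg ℬ ℬ₀ g) :
    β₀.IsGraded 𝒜₀ ℬ₀ (truncGrading 𝒳 Λ) where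
  internal := truncGrading_isInternal hβ.internal
  left_mem x y a ha m hm := by
    change (β₀.left a m : X) ∈ 𝒳 (x * y)
    rw [h.left]
    exact hβ.left_mem x y _ ((hf.mem_iff x a).mp ha) m hm
  right_mem y z m hm b hb := by
    change (β₀.rightLinear b m : X) ∈ 𝒳 (y * z)
    rw [h.right]
    exact hβ.right_mem y z m hm _ ((hg.mem_iff z b).mp hb)

/-- Multiplication by degrees in `Λ` preserves both `Λ` and its complement in `Γ`, so both `X_Λ` and
the sum of the remaining components are stable. -/
lemma IsTrunc.truncProj_left {β₀ : AlgBimod O A₀ B₀ (truncModule 𝒳 Λ)} {β : AlgBimod O A B X}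
    {f : A₀ →ₐ[O] A} {g : B₀ →ₐ[O] B} (h : β₀.IsTrunc β f g) (hβ : β.IsGraded 𝒜 ℬ 𝒳)
    (hf : IsTruncAlg 𝒜 𝒜₀ f) (a : A₀) (x : X) :
    truncProj hβ.internal Λ (β.left (f a) x) = β₀.left a (truncProj hβ.internal Λ x) := by
  classical
  suffices H : (LinearMap.llcomp O _ _ _ (truncProj hβ.internal Λ)) ∘ₗ β.left.toLinearMap ∘ₗ
      f.toLinearMap = (LinearMap.lcomp O _ (truncProj hβ.internal Λ)) ∘ₗ β₀.left.toLinearMap from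
    LinearMap.congr_fun (LinearMap.congr_fun H a) x
  refine linearMap_ext₂_of_iSup hf.iSup_eq_top' hβ.internal.submodule_iSup_eq_top
    fun z a ha w x hx => ?_
  change truncProj hβ.internal Λ (β.left (f a) x) = β₀.left a (truncProj hβ.internal Λ x)
  by_cases hw : w ∈ Λ
  · lift x to truncModule 𝒳 Λ using le_truncModule hw hx
    rw [truncProj_subtype, ← h.left, truncProj_subtype]
  · rw [truncProj_of_notMem _ hw hx, map_zero]
    refine truncProj_of_notMem _ ?_ (hβ.left_mem z w (f a) ((hf.mem_iff z a).mp ha) x hx)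
    rwa [Subgroup.mul_mem_cancel_left _ z.2]

lemma IsTrunc.truncProj_right {β₀ : AlgBimod O A₀ B₀ (truncModule 𝒳 Λ)} {β : AlgBimod O A B X}
    {f : A₀ →ₐ[O] A} {g : B₀ →ₐ[O] B} (h : β₀.IsTrunc β f g) (hβ : β.IsGraded 𝒜 ℬ 𝒳)
    (hg : IsTruncAlg ℬ ℬ₀ g) (b : B₀) (x : X) :
    truncProj hβ.internal Λ (β.rightLinear (g b) x) =
      β₀.rightLinear b (truncProj hβ.internal Λ x) := by
  classical
  suffices H : (LinearMap.llcomp O _ _ _ (truncProj hβ.internal Λ)) ∘ₗ β.rightLinear ∘ₗ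
      g.toLinearMap = (LinearMap.lcomp O _ (truncProj hβ.internal Λ)) ∘ₗ β₀.rightLinear from
    LinearMap.congr_fun (LinearMap.congr_fun H b) x
  refine linearMap_ext₂_of_iSup hg.iSup_eq_top' hβ.internal.submodule_iSup_eq_top
    fun z b hb w x hx => ?_
  change truncProj hβ.internal Λ (β.rightLinear (g b) x) =
    β₀.rightLinear b (truncProj hβ.internal Λ x)
  by_cases hw : w ∈ Λ
  · lift x to truncModule 𝒳 Λ using le_truncModule hw hx
    rw [truncProj_subtype, ← h.right, truncProj_subtype]
  · rw [truncProj_of_notMem _ hw hx, map_zero]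
    refine truncProj_of_notMem _ ?_ (hβ.right_mem w z x hx (g b) ((hg.mem_iff z b).mp hb))
    rwa [Subgroup.mul_mem_cancel_right _ z.2]

lemma tmul_balanced (β : AlgBimod O A B X) (γ : AlgBimod O B C Y) (x : X) (b : B) (y : Y) :
    tmul β γ (β.rightLinear b x) y = tmul β γ x (γ.left b y) :=
  (Submodule.Quotient.eq _).mpr (Submodule.subset_span ⟨x, b, y, rfl⟩)

section TensorTrunc

variable {β : AlgBimod O A B X} {γ : AlgBimod O B C Y}
  {β₀ : AlgBimod O A₀ B₀ (truncModule 𝒳 Λ)} {γ₀ : AlgBimod O B₀ C₀ (truncModule 𝒴 Λ)}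
  {f : A₀ →ₐ[O] A} {g : B₀ →ₐ[O] B} {k : C₀ →ₐ[O] C}

/-- The map from the tensor product of the truncations to the tensor product. -/
def tensorTrunc (hβ : β₀.IsTrunc β f g) (hγ : γ₀.IsTrunc γ g k) :
    Tensor β₀ γ₀ →ₗ[O] Tensor β γ :=
  (balancing β₀ γ₀).mapQ (balancing β γ)
    (TensorProduct.map (truncModule 𝒳 Λ).subtype (truncModule 𝒴 Λ).subtype) (by
      refine Submodule.span_le.mpr ?_
      rintro _ ⟨x, b, y, rfl⟩
      refine Submodule.subset_span ⟨x, g b, y, ?_⟩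
      have h1 := hβ.right b x
      have h2 := hγ.left b y
      rw [rightLinear_apply, rightLinear_apply] at h1
      simp [h1, h2])

lemma tensor_ext {β : AlgBimod O A B X} {γ : AlgBimod O B C Y} {Z : Type*} [AddCommGroup Z]
    [Module O Z] {F F' : Tensor β γ →ₗ[O] Z} (h : ∀ x y, F (tmul β γ x y) = F' (tmul β γ x y)) :
    F = F' :=
  Submodule.linearMap_qext _ (TensorProduct.ext' h)

lemma tensorTrunc_left (hβ : β₀.IsTrunc β f g) (hγ : γ₀.IsTrunc γ g k) (a : A₀)
    (t : Tensor β₀ γ₀) : tensorTrunc hβ hγ ((β₀.tensor γ₀).left a t) =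
      (β.tensor γ).left (f a) (tensorTrunc hβ hγ t) := by
  suffices h : tensorTrunc hβ hγ ∘ₗ (β₀.tensor γ₀).left a =
      (β.tensor γ).left (f a) ∘ₗ tensorTrunc hβ hγ from LinearMap.congr_fun h t
  refine tensor_ext fun x y => ?_
  change tmul β γ (β₀.left a x) y = tmul β γ (β.left (f a) x) y
  rw [hβ.left]

lemma tensorTrunc_right (hβ : β₀.IsTrunc β f g) (hγ : γ₀.IsTrunc γ g k) (c : C₀)
    (t : Tensor β₀ γ₀) : tensorTrunc hβ hγ (((β₀.tensor γ₀).right c).unop t) =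
      ((β.tensor γ).right (k c)).unop (tensorTrunc hβ hγ t) := by
  suffices h : tensorTrunc hβ hγ ∘ₗ ((β₀.tensor γ₀).right c).unop =
      ((β.tensor γ).right (k c)).unop ∘ₗ tensorTrunc hβ hγ from LinearMap.congr_fun h t
  refine tensor_ext fun x y => ?_
  change tmul β γ x (γ₀.rightLinear c y) = tmul β γ x (γ.rightLinear (k c) y)
  rw [hγ.right]

/-- A tensor `x ⊗ y` with degrees `s`, `r` outside `Λ` but `s * r = z ∈ Λ` is rewritten as `x v ⊗ u
y`, where `u` is invertible of degree `s` with inverse `v`; the new degrees `1` and `z` lie in `Λ`.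
-/
lemma map_tensorTrunc (hβ : β₀.IsTrunc β f g) (hγ : γ₀.IsTrunc γ g k)
    (hX : β.IsGraded 𝒜 ℬ 𝒳) (hY : γ.IsGraded ℬ 𝒞 𝒴) (hg : IsTruncAlg ℬ ℬ₀ g) (z : Λ) :
    (tensorGrading β₀ γ₀ (truncGrading 𝒳 Λ) (truncGrading 𝒴 Λ) z).map (tensorTrunc hβ hγ) =
      tensorGrading β γ 𝒳 𝒴 z := by
  refine le_antisymm ?_ ?_
  · rw [tensorGrading, Submodule.map_span_le]
    rintro _ ⟨s, r, rfl, x, hx, y, hy, rfl⟩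
    exact Submodule.subset_span ⟨s, r, rfl, x, hx, y, hy, rfl⟩
  · refine Submodule.span_le.mpr ?_
    rintro _ ⟨s, r, hsr, x, hx, y, hy, rfl⟩
    obtain ⟨u, hu, v, hv, huv, hvu⟩ := hg.exists_unit s
    have h1 : tmul β γ x y = tmul β γ (β.rightLinear v x) (γ.left u y) := by
      rw [tmul_balanced, ← Module.End.mul_apply, ← map_mul, hvu, map_one, Module.End.one_apply]
    have hx' : β.rightLinear v x ∈ 𝒳 1 := by
      simpa [rightLinear_apply] using hX.right_mem s s⁻¹ x hx v hv
    have hy' : γ.left u y ∈ 𝒴 z := by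
      simpa [hsr] using hY.left_mem s r u hu y hy
    rw [h1]
    exact ⟨tmul β₀ γ₀ ⟨_, le_truncModule Λ.one_mem hx'⟩ ⟨_, le_truncModule z.2 hy'⟩,
      Submodule.subset_span ⟨1, z, one_mul z, _, hx', _, hy', rfl⟩, rfl⟩

lemma tensorGrading_iSup (h : ⨆ z, 𝒳 z = ⊤) (h' : ⨆ z, 𝒴 z = ⊤) :
    ⨆ z, tensorGrading β γ 𝒳 𝒴 z = ⊤ := by
  suffices H : (⨆ z, tensorGrading β γ 𝒳 𝒴 z).mkQ = 0 by
    rw [← Submodule.ker_mkQ (⨆ z, tensorGrading β γ 𝒳 𝒴 z), H, LinearMap.ker_zero]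
  refine Submodule.linearMap_qext _ (TensorProduct.ext ?_)
  refine linearMap_ext₂_of_iSup h h' fun z x hx w y hy => ?_
  refine (Submodule.Quotient.mk_eq_zero _).mpr ?_
  exact (le_iSup (tensorGrading β γ 𝒳 𝒴) (z * w))
    (Submodule.subset_span ⟨z, w, rfl, x, hx, y, hy, rfl⟩)

/-- A left inverse is built by averaging over cosets: `x ⊗ y` goes to the sum over `t Λ` of `π(x
u_t) ⊗ π(v_t y)`, with `π` the projection to the truncation and `u_t` invertible of degree `t` with
inverse `v_t`. For homogeneous `x` only one coset contributes. -/
lemma tensorTrunc_injective [Finite Γ] (hβ : β₀.IsTrunc β f g) (hγ : γ₀.IsTrunc γ g k)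
    (hX : β.IsGraded 𝒜 ℬ 𝒳) (hY : γ.IsGraded ℬ 𝒞 𝒴) (hg : IsTruncAlg ℬ ℬ₀ g) :
    Function.Injective (tensorTrunc hβ hγ) := by
  classical
  have := Fintype.ofFinite (Γ ⧸ Λ)
  choose u hu v hv huv hvu using hg.exists_unit
  let πX := truncProj hX.internal Λ
  let πY := truncProj hY.internal Λ
  let Ψ : X ⊗[O] Y →ₗ[O] Tensor β₀ γ₀ := ∑ c : Γ ⧸ Λ, (balancing β₀ γ₀).mkQ ∘ₗ
    TensorProduct.map (πX ∘ₗ β.rightLinear (u c.out)) (πY ∘ₗ γ.left (v c.out))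
  have hΨ : ∀ x y, Ψ (x ⊗ₜ y) = ∑ c : Γ ⧸ Λ,
      tmul β₀ γ₀ (πX (β.rightLinear (u c.out) x)) (πY (γ.left (v c.out) y)) := by
    intro x y
    simp only [Ψ, LinearMap.sum_apply]
    rfl
  have hbal : ∀ x y b, Ψ (β.rightLinear b x ⊗ₜ y) = Ψ (x ⊗ₜ γ.left b y) := by
    intro x y b
    suffices H : Ψ ∘ₗ (TensorProduct.mk O X Y).flip y ∘ₗ β.rightLinear.flip x =
        Ψ ∘ₗ TensorProduct.mk O X Y x ∘ₗ γ.left.toLinearMap.flip y from LinearMap.congr_fun H b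
    refine linearMap_ext_of_iSup hg.iSup_eq_top fun z b hb => ?_
    change Ψ (β.rightLinear b x ⊗ₜ y) = Ψ (x ⊗ₜ γ.left b y)
    rw [hΨ, hΨ]
    -- For `b` of degree `z`, the term of `c` on the left matches that of `z • c` on the right: with
    -- representatives `t` and `s`, the element `v_s b u_t` has degree `s⁻¹ z t ∈ Λ`, hence may
    -- cross both the projections and the tensor sign.
    refine Fintype.sum_equiv (MulAction.toPerm z : Equiv.Perm (Γ ⧸ Λ)) _ _ fun c => ?_
    rw [MulAction.toPerm_apply]
    set t := c.out
    set s := (z • c).out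
    have hts : s⁻¹ * z * t ∈ Λ := by
      rw [mul_assoc, ← QuotientGroup.eq, QuotientGroup.out_eq', ← smul_eq_mul,
        ← MulAction.Quotient.smul_coe, QuotientGroup.out_eq']
    obtain ⟨b₀, hb₀⟩ := hg.exists_eq _ hts _
      (hg.mul_mem _ _ _ (hg.mul_mem _ _ _ (hv s) _ hb) _ (hu t))
    have h1 : β.rightLinear (u t) (β.rightLinear b x) =
        β.rightLinear (g b₀) (β.rightLinear (u s) x) := by
      rw [hb₀, ← rightLinear_mul, ← rightLinear_mul, ← mul_assoc, ← mul_assoc, huv, one_mul]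
    have h2 : γ.left (v s) (γ.left b y) = γ.left (g b₀) (γ.left (v t) y) := by
      rw [hb₀, ← Module.End.mul_apply, ← map_mul, ← Module.End.mul_apply, ← map_mul,
        mul_assoc _ (u t), huv, mul_one]
    rw [h1, h2]
    simp only [πX, πY]
    rw [hβ.truncProj_right hX hg, hγ.truncProj_left hY hg, tmul_balanced]
  let Ψ' : Tensor β γ →ₗ[O] Tensor β₀ γ₀ := (balancing β γ).liftQ Ψ (by
    refine Submodule.span_le.mpr ?_
    rintro _ ⟨x, b, y, rfl⟩
    rw [SetLike.mem_coe, LinearMap.mem_ker, map_sub, sub_eq_zero]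
    exact hbal x y b)
  have hΨ' : Ψ' ∘ₗ tensorTrunc hβ hγ = LinearMap.id := by
    refine tensor_ext fun x y => ?_
    change Ψ ((x : X) ⊗ₜ (y : Y)) = tmul β₀ γ₀ x y
    suffices H : Ψ ∘ₗ TensorProduct.map (truncModule 𝒳 Λ).subtype (truncModule 𝒴 Λ).subtype =
      (balancing β₀ γ₀).mkQ from LinearMap.congr_fun H (x ⊗ₜ y)
    refine TensorProduct.ext ?_
    refine linearMap_ext₂_of_iSup truncGrading_iSup truncGrading_iSup fun z x hx w y hy => ?_
    change Ψ ((x : X) ⊗ₜ (y : Y)) = tmul β₀ γ₀ x y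
    -- The chosen representative `t` of the trivial coset need not be `1`, but it lies in `Λ`, so
    -- `u_t` and `v_t` come from the truncated algebra and cancel across the tensor sign.
    rw [hΨ, Finset.sum_eq_single ((1 : Γ) : Γ ⧸ Λ)]
    · set t := ((1 : Γ) : Γ ⧸ Λ).out
      have ht : t ∈ Λ := by
        have := QuotientGroup.out_eq' ((1 : Γ) : Γ ⧸ Λ)
        rwa [eq_comm, QuotientGroup.eq, inv_one, one_mul] at this
      obtain ⟨u₀, hu₀⟩ := hg.exists_eq _ ht _ (hu t)
      obtain ⟨v₀, hv₀⟩ := hg.exists_eq _ (Λ.inv_mem ht) _ (hv t)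
      have huv₀ : u₀ * v₀ = 1 := hg.injective (by rw [map_mul, hu₀, hv₀, huv, map_one])
      rw [← hu₀, ← hv₀]
      simp only [πX, πY]
      rw [hβ.truncProj_right hX hg, hγ.truncProj_left hY hg, truncProj_subtype, truncProj_subtype,
        ← tmul_balanced, ← rightLinear_mul, huv₀, rightLinear_one]
    · intro c _ hc
      have : πX (β.rightLinear (u c.out) x) = 0 := by
        refine truncProj_of_notMem _ ?_ (hX.right_mem z _ _ hx _ (hu _))
        rw [Subgroup.mul_mem_cancel_left _ z.2]
        intro h
        refine hc ?_
        rw [← QuotientGroup.out_eq' c, eq_comm, QuotientGroup.eq]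
        simpa using h
      rw [this]
      simp [tmul]
    · simp
  exact Function.LeftInverse.injective (LinearMap.congr_fun hΨ')

end TensorTrunc

end AlgBimod

open AlgBimod

/-- A graded isomorphism of `X ⊗_B Y` with `A` restricts to the truncations. -/
lemma GradedIso.trunc [Finite Γ] {β : AlgBimod O A B X} {γ : AlgBimod O B A Y}
    {β₀ : AlgBimod O A₀ B₀ (truncModule 𝒳 Λ)} {γ₀ : AlgBimod O B₀ A₀ (truncModule 𝒴 Λ)}
    {f : A₀ →ₐ[O] A} {g : B₀ →ₐ[O] B} (hβ : β₀.IsTrunc β f g) (hγ : γ₀.IsTrunc γ g f)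
    (hX : β.IsGraded 𝒜 ℬ 𝒳) (hY : γ.IsGraded ℬ 𝒜 𝒴) (hf : IsTruncAlg 𝒜 𝒜₀ f)
    (hg : IsTruncAlg ℬ ℬ₀ g)
    (h : GradedIso (β.tensor γ) (tensorGrading β γ 𝒳 𝒴) (regular O A) 𝒜) :
    GradedIso (β₀.tensor γ₀) (tensorGrading β₀ γ₀ (truncGrading 𝒳 Λ) (truncGrading 𝒴 Λ))
      (regular O A₀) 𝒜₀ := by
  obtain ⟨e, hl, hr, hz⟩ := h
  let j : Tensor β₀ γ₀ →ₗ[O] A := e.toLinearMap ∘ₗ tensorTrunc hβ hγ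
  have hj : Function.Injective j :=
    e.injective.comp (tensorTrunc_injective hβ hγ hX hY hg)
  have hf𝒜 : ∀ z : Λ, (𝒜₀ z).map f.toLinearMap = 𝒜 z := by
    intro z
    refine le_antisymm ?_ fun a ha => ?_
    · rw [Submodule.map_le_iff_le_comap]
      exact fun a ha => (hf.mem_iff z a).mp ha
    · obtain ⟨a₀, rfl⟩ := hf.exists_eq z z.2 a ha
      exact ⟨a₀, (hf.mem_iff z a₀).mpr ha, rfl⟩
  have hj𝒜 : ∀ z : Λ, (tensorGrading β₀ γ₀ (truncGrading 𝒳 Λ) (truncGrading 𝒴 Λ) z).map j =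
      𝒜 z := by
    intro z
    rw [Submodule.map_comp, map_tensorTrunc hβ hγ hX hY hg, ← hz]
  -- Both ranges are the sum of the `𝒜 z` for `z ∈ Λ`.
  have hrange : LinearMap.range j = LinearMap.range f.toLinearMap := by
    rw [← Submodule.map_top, ← Submodule.map_top, ← hf.iSup_eq_top',
      ← tensorGrading_iSup truncGrading_iSup truncGrading_iSup, Submodule.map_iSup,
      Submodule.map_iSup]
    simp only [hf𝒜, hj𝒜]
  let e₀ : Tensor β₀ γ₀ ≃ₗ[O] A₀ := (LinearEquiv.ofInjective j hj).trans
    ((LinearEquiv.ofEq _ _ hrange).trans (LinearEquiv.ofInjective f.toLinearMap hf.injective).symm)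
  have he₀ : ∀ t, f (e₀ t) = j t := by
    intro t
    have := congrArg Subtype.val ((LinearEquiv.ofInjective f.toLinearMap
      hf.injective).apply_symm_apply (LinearEquiv.ofEq _ _ hrange (LinearEquiv.ofInjective j hj t)))
    exact this
  refine ⟨e₀, fun a t => hf.injective ?_, fun b t => hf.injective ?_, fun z => ?_⟩
  · rw [he₀]
    change e (tensorTrunc hβ hγ _) = f (a * e₀ t)
    rw [tensorTrunc_left, hl, map_mul, he₀]
    rfl
  · rw [he₀]
    change e (tensorTrunc hβ hγ _) = f (e₀ t * b)
    rw [tensorTrunc_right, hr, map_mul, he₀]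
    rfl
  · refine Submodule.map_injective_of_injective (f := f.toLinearMap) hf.injective ?_
    rw [hf𝒜, ← hj𝒜, ← Submodule.map_comp]
    congr 1
    exact LinearMap.ext he₀

/-- A graded Morita equivalence restricts to the truncations. -/
lemma InducesGradedMorita.trunc [Finite Γ] {X : Type v} [AddCommGroup X] [Module O X]
    {𝒳 : Γ → Submodule O X} {β : AlgBimod O A B X}
    {β₀ : AlgBimod O A₀ B₀ (truncModule 𝒳 Λ)} {f : A₀ →ₐ[O] A} {g : B₀ →ₐ[O] B}
    (hβ : β₀.IsTrunc β f g) (hf : IsTruncAlg 𝒜 𝒜₀ f) (hg : IsTruncAlg ℬ ℬ₀ g)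
    (h : InducesGradedMorita β 𝒜 ℬ 𝒳) :
    InducesGradedMorita β₀ 𝒜₀ ℬ₀ (truncGrading 𝒳 Λ) := by
  obtain ⟨hX, Y, _, _, γ, 𝒴, hY, hXY, hYX⟩ := h
  have hγ := trunc_isTrunc hY hg hf
  exact ⟨hβ.isGraded hX hf hg, truncModule 𝒴 Λ, inferInstance, inferInstance,
    AlgBimod.trunc hY hg hf, truncGrading 𝒴 Λ, hγ.isGraded hY hg hf,
    hXY.trunc hβ hγ hX hY hf hg, hYX.trunc hγ hβ hY hX hg hf⟩

end TruncMorita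

/-! ### Transport along isomorphisms -/

section Transport

variable {O : Type*} [CommRing O] {K K' M M' : Type*} [Group K] [Group K'] [AddCommGroup M]
  [Module O M] [AddCommGroup M'] [Module O M'] {ρ : Representation O K M}
  {ρ' : Representation O K' M'}

/-- A bare map `φ` is enough: an endomorphism commuting with every operator of `ρ'` commutes in
particular with the transports of those of `ρ`. -/
lemma IsIndecomposable.of_equiv (h : IsIndecomposable ρ) (φ : K → K') (e : M ≃ₗ[O] M')
    (he : ∀ k m, e (ρ k m) = ρ' (φ k) (e m)) : IsIndecomposable ρ' := by
  rw [isIndecomposable_iff] at h ⊢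
  obtain ⟨hM, h⟩ := h
  refine ⟨e.symm.toEquiv.nontrivial, fun f hf hfg => ?_⟩
  have h1 : IsIdempotentElem (e.symm.conj f) := by
    rw [IsIdempotentElem, Module.End.mul_eq_comp, ← LinearEquiv.conj_comp,
      ← Module.End.mul_eq_comp, hf.eq]
  rcases h _ h1 (fun k => LinearMap.ext fun m => e.injective (by
    have := LinearMap.congr_fun (hfg (φ k)) (e m)
    simp only [Module.End.mul_apply] at this
    simp [LinearEquiv.conj_apply, he, this])) with h | h
  · left
    exact e.symm.conj.injective (by rw [h, map_zero])
  · right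
    refine e.symm.conj.injective ?_
    rw [h, Module.End.one_eq_id, Module.End.one_eq_id, LinearEquiv.conj_id]

lemma projective_asModule_of_equiv (φ : K ≃* K') (e : M ≃ₗ[O] M')
    (he : ∀ k m, e (ρ k m) = ρ' (φ k) (e m)) (h : Module.Projective O[K] ρ.asModule) :
    Module.Projective O[K'] ρ'.asModule := by
  let E : O[K] ≃+* O[K'] := MonoidAlgebra.mapDomainRingEquiv O φ
  have := RingHomInvPair.of_ringEquiv E
  have := RingHomInvPair.of_ringEquiv_symm E
  have key : ∀ (r : O[K]) (m : M), e (ρ.asAlgebraHom r m) = ρ'.asAlgebraHom (E r) (e m) := by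
    intro r m
    induction r using MonoidAlgebra.induction_linear with
    | zero => simp
    | add r s hr hs => simp [hr, hs]
    | single g r => simp [E, he]
  let e' : ρ.asModule ≃+ ρ'.asModule :=
    (ρ.asModuleEquiv.trans (e.trans ρ'.asModuleEquiv.symm)).toAddEquiv
  let e'' : ρ.asModule ≃ₛₗ[(E : O[K] →+* O[K'])] ρ'.asModule :=
    { e' with
      map_smul' := fun r x => ρ'.asModuleEquiv.injective (by
        change e (ρ.asModuleEquiv (r • x)) = ρ'.asModuleEquiv (E r • e' x)
        rw [Representation.asModuleEquiv_map_smul, Representation.asModuleEquiv_map_smul, key]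
        rfl) }
  exact Module.Projective.of_equiv e''

lemma IsBlock.map {b : O[K]} (hb : IsBlock b) (E : O[K] ≃ₐ[O] O[K']) : IsBlock (E b) where
  idem := hb.idem.map E
  central := by
    rw [Subalgebra.mem_center_iff]
    intro c
    obtain ⟨c, rfl⟩ := E.surjective c
    rw [← map_mul, ← map_mul, Subalgebra.mem_center_iff.mp hb.central]
  ne_zero := by simpa using hb.ne_zero
  primitive e he hi hm := by
    obtain ⟨e, rfl⟩ := E.surjective e
    have h1 : e ∈ Subalgebra.center O O[K] := by
      rw [Subalgebra.mem_center_iff] at he ⊢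
      exact fun c => E.injective (by rw [map_mul, map_mul, he])
    have h2 : IsIdempotentElem e := E.injective (by rw [map_mul, hi.eq])
    have h3 : e * b = e := E.injective (by rw [map_mul, hm])
    exact (hb.primitive e h1 h2 h3).imp (fun h => by rw [h, map_zero]) (fun h => by rw [h])

end Transport

/-! ### Truncation of block algebras -/

section TruncBlock

variable {O : Type*} [CommRing O] {G Γ : Type*} [Group G] [Group Γ] {ω : G →* Γ} {Λ : Subgroup Γ}

variable (ω Λ) in
/-- The kernel of `ω` is isomorphic to the kernel of the restriction `ω⁻¹(Λ) → Λ`. -/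
def truncKerEquiv : ω.ker ≃* (ω.subgroupComap Λ).ker :=
  MulEquiv.ofBijective (truncKer ω Λ)
    ⟨fun _ _ h => Subtype.ext (congrArg (fun n => (n.1 : G)) h),
      fun n => ⟨⟨n.1, congrArg Subtype.val n.2⟩, rfl⟩⟩

variable (O ω Λ) in
/-- The inclusion of the group algebra of `ω⁻¹(Λ)` into `O G`. -/
def inclHom : O[Λ.comap ω] →ₐ[O] O[G] :=
  MonoidAlgebra.mapDomainAlgHom O O (Λ.comap ω).subtype

lemma inclHom_injective : Function.Injective (inclHom O ω Λ) :=
  MonoidAlgebra.mapDomain_injective Subtype.val_injective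

lemma inclHom_coeff_coe (a : O[Λ.comap ω]) (h : Λ.comap ω) :
    (inclHom O ω Λ a).coeff (h : G) = a.coeff h :=
  Finsupp.mapDomain_apply Subtype.val_injective a.coeff h

lemma inclHom_coeff_of_notMem (a : O[Λ.comap ω]) {g : G} (hg : g ∉ Λ.comap ω) :
    (inclHom O ω Λ a).coeff g = 0 :=
  Finsupp.mapDomain_of_notMem_range a.coeff g (by simpa using hg)

lemma inclHom_extend (b : O[ω.ker]) :
    inclHom O ω Λ (extend (ω.subgroupComap Λ) (truncBlock ω Λ b)) = extend ω b := by
  suffices h : (inclHom O ω Λ).comp ((MonoidAlgebra.mapDomainAlgHom O O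
      (ω.subgroupComap Λ).ker.subtype).comp (MonoidAlgebra.mapDomainAlgHom O O (truncKer ω Λ))) =
      MonoidAlgebra.mapDomainAlgHom O O ω.ker.subtype from AlgHom.congr_fun h b
  rw [inclHom, ← MonoidAlgebra.mapDomainAlgHom_comp, ← MonoidAlgebra.mapDomainAlgHom_comp]
  rfl

lemma IsInvariantBlock.trunc {b : O[ω.ker]} (hb : IsInvariantBlock ω b) :
    IsInvariantBlock (ω.subgroupComap Λ) (truncBlock ω Λ b) where
  toIsBlock := hb.toIsBlock.map (MonoidAlgebra.domCongr O O (truncKerEquiv ω Λ))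
  invariant h := by
    have key : (MonoidAlgebra.mapDomainAlgHom O O (MulAut.conjNormal h :
        MulAut (ω.subgroupComap Λ).ker).toMonoidHom).comp
        (MonoidAlgebra.mapDomainAlgHom O O (truncKer ω Λ)) =
        (MonoidAlgebra.mapDomainAlgHom O O (truncKer ω Λ)).comp
          (MonoidAlgebra.mapDomainAlgHom O O
            (MulAut.conjNormal (h : G) : MulAut ω.ker).toMonoidHom) := by
      rw [← MonoidAlgebra.mapDomainAlgHom_comp, ← MonoidAlgebra.mapDomainAlgHom_comp]
      congr 1
    refine (AlgHom.congr_fun key b).trans ?_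
    exact congrArg (MonoidAlgebra.mapDomainAlgHom O O (truncKer ω Λ)) (hb.invariant h)

/-- An invariant block of the kernel is central in `O G`. -/
lemma IsInvariantBlock.single_mul_extend {b : O[ω.ker]} (hb : IsInvariantBlock ω b) (g : G) :
    MonoidAlgebra.single g 1 * extend ω b = extend ω b * MonoidAlgebra.single g (1 : O) := by
  have key : ∀ c : O[ω.ker], MonoidAlgebra.single g 1 * extend ω c =
      extend ω (MonoidAlgebra.mapDomainAlgHom O O
        (MulAut.conjNormal g : MulAut ω.ker).toMonoidHom c) * MonoidAlgebra.single g (1 : O) := by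
    intro c
    induction c using MonoidAlgebra.induction_linear with
    | zero => simp [extend]
    | add c d hc hd =>
      simp only [extend, map_add] at hc hd ⊢
      rw [mul_add, hc, hd, add_mul]
    | single n r => simp [extend, MonoidAlgebra.single_mul_single]
  rw [key, hb.invariant]

variable (O) in
/-- The elements of `O G` supported on `ω⁻¹(x)`. -/
def fiberSupported (ω : G →* Γ) (x : Γ) : Submodule O O[G] where
  carrier := {a | ∀ g : G, a.coeff g ≠ 0 → ω g = x}
  zero_mem' := fun g hg => by simp at hg
  add_mem' := fun {a c} ha hc g hg => by
    by_cases h : a.coeff g = 0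
    · exact hc g fun h' => hg (by simp [h, h'])
    · exact ha g h
  smul_mem' := fun r a ha g hg => ha g fun h => hg (by simp [h])

lemma mul_mem_fiberSupported {x y : Γ} {a c : O[G]} (ha : a ∈ fiberSupported O ω x)
    (hc : c ∈ fiberSupported O ω y) : a * c ∈ fiberSupported O ω (x * y) := by
  classical
  intro g hg
  have := MonoidAlgebra.support_coeff_mul_subset a c (Finsupp.mem_support_iff.mpr hg)
  obtain ⟨s, hs, t, ht, rfl⟩ := Finset.mem_mul.mp this
  rw [map_mul, ha s (Finsupp.mem_support_iff.mp hs), hc t (Finsupp.mem_support_iff.mp ht)]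

lemma single_mem_fiberSupported (g : G) (r : O) :
    MonoidAlgebra.single g r ∈ fiberSupported O ω (ω g) := by
  classical
  intro h hh
  rw [MonoidAlgebra.coeff_single, Finsupp.single_apply] at hh
  split_ifs at hh with hgh
  · rw [hgh]
  · exact absurd rfl hh

lemma extend_mem_fiberSupported (b : O[ω.ker]) : extend ω b ∈ fiberSupported O ω 1 := by
  intro g hg
  by_contra h
  exact hg (Finsupp.mapDomain_of_notMem_range b.coeff g (by simpa using h))

/-- An algebra homomorphism restricts to the corners of idempotents that correspond to each
other. -/
def cornerMap {R S : Type*} [Ring R] [Algebra O R] [Ring S] [Algebra O S] {e : R} {e' : S}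
    (he : IsIdempotentElem e) (he' : IsIdempotentElem e') (f : R →ₐ[O] S) (hf : f e = e') :
    he.Corner →ₐ[O] he'.Corner :=
  AlgHom.ofLinearMap
    { toFun := fun a => ⟨f a.1, by
        obtain ⟨a, c, rfl⟩ := a
        exact ⟨f c, by simp [hf]⟩⟩
      map_add' := fun a c => Subtype.ext (map_add f a.1 c.1)
      map_smul' := fun r a => Subtype.ext (map_smul f r a.1) }
    (Subtype.ext hf) (fun a c => Subtype.ext (map_mul f a.1 c.1))

/-- The projection of an algebra onto the corner of an idempotent. -/
def toCorner {R : Type*} [Ring R] [Algebra O R] {e : R} (he : IsIdempotentElem e) :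
    R →ₗ[O] he.Corner where
  toFun a := ⟨e * a * e, a, rfl⟩
  map_add' a c := Subtype.ext (by change _ = e * a * e + e * c * e; noncomm_ring)
  map_smul' r a := Subtype.ext (by change _ = r • (e * a * e); simp)

lemma toCorner_coe {R : Type*} [Ring R] [Algebra O R] {e : R} (he : IsIdempotentElem e)
    (a : he.Corner) : toCorner (O := O) he a.1 = a := by
  obtain ⟨a, c, rfl⟩ := a
  refine Subtype.ext ?_
  change e * (e * c * e) * e = e * c * e
  rw [← mul_assoc, ← mul_assoc, he.eq, mul_assoc, he.eq]

lemma toCorner_mem_blockGrading {b : O[ω.ker]} (hb : IsInvariantBlock ω b) {x : Γ} {a : O[G]}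
    (ha : a ∈ fiberSupported O ω x) : toCorner (O := O) hb.idem_extend a ∈ blockGrading hb x := by
  have := mul_mem_fiberSupported
    (mul_mem_fiberSupported (extend_mem_fiberSupported b) ha) (extend_mem_fiberSupported b)
  rwa [one_mul, mul_one] at this

/-- Every element of the corner equals `b a b`, and `b g b` is homogeneous of degree `ω g` because
`b` is supported in degree `1`. -/
lemma blockGrading_iSup {b : O[ω.ker]} (hb : IsInvariantBlock ω b) :
    ⨆ x, blockGrading hb x = ⊤ := by
  rw [eq_top_iff]
  rintro a -
  rw [← toCorner_coe (O := O) hb.idem_extend a]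
  induction a.1 using MonoidAlgebra.induction_linear with
  | zero => simp
  | add c d hc hd => rw [map_add]; exact Submodule.add_mem _ hc hd
  | single g r =>
    exact (le_iSup (blockGrading hb) (ω g))
      (toCorner_mem_blockGrading hb (single_mem_fiberSupported g r))

/-- The inclusion of the block algebra of `ω⁻¹(Λ)` into the block algebra of `G`. -/
def blockIncl {b : O[ω.ker]} (hb : IsInvariantBlock ω b)
    (hb₀ : IsInvariantBlock (ω.subgroupComap Λ) (truncBlock ω Λ b)) :
    BlockAlg hb₀ →ₐ[O] BlockAlg hb :=
  cornerMap hb₀.idem_extend hb.idem_extend (inclHom O ω Λ) (inclHom_extend b)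

/-- Surjectivity of `ω` supplies `g` in each degree, and since `b` is central, `b g b` is invertible
with inverse `b g⁻¹ b`. -/
lemma blockIncl_isTruncAlg (hω : Function.Surjective ω) {b : O[ω.ker]}
    (hb : IsInvariantBlock ω b) (hb₀ : IsInvariantBlock (ω.subgroupComap Λ) (truncBlock ω Λ b)) :
    IsTruncAlg (blockGrading hb) (blockGrading hb₀) (blockIncl hb hb₀) where
  injective a c h := Subtype.ext (inclHom_injective (congrArg Subtype.val h))
  mem_iff x a := by
    constructor
    · intro ha g hg
      by_cases hgΛ : g ∈ Λ.comap ω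
      · have : (inclHom O ω Λ a.1).coeff ((⟨g, hgΛ⟩ : Λ.comap ω) : G) ≠ 0 := hg
        rw [inclHom_coeff_coe] at this
        exact congrArg Subtype.val (ha ⟨g, hgΛ⟩ this)
      · exact absurd (inclHom_coeff_of_notMem a.1 hgΛ) hg
    · intro ha h hh
      refine Subtype.ext (ha (h : G) ?_)
      change (inclHom O ω Λ a.1).coeff (h : G) ≠ 0
      rwa [inclHom_coeff_coe]
  exists_eq x hx a ha := by
    have h1 : (a.1.coeff.support : Set G) ⊆ Set.range (Subtype.val : Λ.comap ω → G) := by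
      intro g hg
      refine ⟨⟨g, ?_⟩, rfl⟩
      rw [Subgroup.mem_comap, ha g (Finsupp.mem_support_iff.mp hg)]
      exact hx
    -- The restriction of `a` to `ω⁻¹(Λ)` already maps to `a`; multiplying by the block on both
    -- sides places it in the corner without changing its image.
    refine ⟨toCorner (O := O) hb₀.idem_extend
      (MonoidAlgebra.comapDomain Subtype.val Subtype.val_injective a.1), ?_⟩
    refine Eq.trans ?_ (toCorner_coe (O := O) hb.idem_extend a)
    refine Subtype.ext ?_
    change inclHom O ω Λ (_ * _ * _) = _ * _ * _
    rw [map_mul, map_mul, inclHom_extend]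
    congr 2
    exact MonoidAlgebra.mapDomain_comapDomain h1 Subtype.val_injective
  iSup_eq_top := blockGrading_iSup hb
  iSup_eq_top' := blockGrading_iSup hb₀
  mul_mem x y a ha c hc := mul_mem_fiberSupported ha hc
  exists_unit x := by
    obtain ⟨g, rfl⟩ := hω x
    have hu : ∀ g h : G, g * h = 1 →
        toCorner (O := O) hb.idem_extend (MonoidAlgebra.single g 1) *
          toCorner (O := O) hb.idem_extend (MonoidAlgebra.single h 1) = 1 := by
      intro g h hgh
      refine Subtype.ext ?_
      change extend ω b * MonoidAlgebra.single g 1 * extend ω b *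
        (extend ω b * MonoidAlgebra.single h 1 * extend ω b) = extend ω b
      have hs : ∀ g, extend ω b * MonoidAlgebra.single g (1 : O) * extend ω b =
          extend ω b * MonoidAlgebra.single g 1 := fun g => by
        rw [mul_assoc, hb.single_mul_extend, ← mul_assoc, hb.idem_extend.eq]
      rw [hs, hs, ← mul_assoc, hs, mul_assoc, MonoidAlgebra.single_mul_single, hgh, mul_one,
        ← MonoidAlgebra.one_def, mul_one]
    refine ⟨_, toCorner_mem_blockGrading hb (single_mem_fiberSupported g 1),
      toCorner (O := O) hb.idem_extend (MonoidAlgebra.single g⁻¹ 1), ?_, hu _ _ (mul_inv_cancel g),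
      hu _ _ (inv_mul_cancel g)⟩
    rw [← map_inv]
    exact toCorner_mem_blockGrading hb (single_mem_fiberSupported g⁻¹ 1)

end TruncBlock

/-! ### Truncation of graded representations -/

section TruncRep

variable {O : Type*} [CommRing O] {G G' Γ : Type*} [Group G] [Group G'] [Group Γ]
  {X : Type v} [AddCommGroup X] [Module O X] {ω : G →* Γ} {ω' : G' →* Γ}
  {ρ : Representation O (G × G') X} {𝒳 : Γ → Submodule O X}

lemma IsGradedRep.trunc (h : IsGradedRep ω ω' ρ 𝒳) (Λ : Subgroup Γ) :
    IsGradedRep (ω.subgroupComap Λ) (ω'.subgroupComap Λ) (truncRep h Λ) (truncGrading 𝒳 Λ) where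
  internal := truncGrading_isInternal h.internal
  apply_mem g g' x m hm := h.apply_mem g g' x m hm

lemma leftHom_truncRep (h : IsGradedRep ω ω' ρ 𝒳) (Λ : Subgroup Γ) (a : O[Λ.comap ω])
    (m : truncModule 𝒳 Λ) : (leftHom (truncRep h Λ) a m : X) = leftHom ρ (inclHom O ω Λ a) m := by
  induction a using MonoidAlgebra.induction_linear with
  | zero => simp
  | add a c ha hc => simp [ha, hc]
  | single g r =>
    simp only [leftHom, inclHom, MonoidAlgebra.lift_single, MonoidAlgebra.mapDomainAlgHom_apply,
      MonoidAlgebra.mapDomain_single]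
    rfl

lemma rightHom_truncRep (h : IsGradedRep ω ω' ρ 𝒳) (Λ : Subgroup Γ) (a : O[Λ.comap ω'])
    (m : truncModule 𝒳 Λ) : ((rightHom (truncRep h Λ) a).unop m : X) =
      (rightHom ρ (inclHom O ω' Λ a)).unop m := by
  induction a using MonoidAlgebra.induction_linear with
  | zero => simp
  | add a c ha hc => simp [ha, hc]
  | single g r =>
    simp only [rightHom, inclHom, MonoidAlgebra.lift_single, MonoidAlgebra.mapDomainAlgHom_apply,
      MonoidAlgebra.mapDomain_single]
    rfl

/-- The inclusion of the group `{(h, h') | ω h = ω' h'}` for `ω⁻¹(Λ)` and `ω'⁻¹(Λ)` into the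
corresponding group for `G` and `G'`. -/
def diagIncl (ω : G →* Γ) (ω' : G' →* Γ) (Λ : Subgroup Γ) :
    diag (ω.subgroupComap Λ) (ω'.subgroupComap Λ) →* diag ω ω' :=
  (((Λ.comap ω).subtype.prodMap (Λ.comap ω').subtype).comp
    (diag (ω.subgroupComap Λ) (ω'.subgroupComap Λ)).subtype).codRestrict (diag ω ω')
    (fun q => congrArg Subtype.val q.2)

/-- The `1`-component is not changed by truncation. -/
def truncOneEquiv (𝒳 : Γ → Submodule O X) (Λ : Subgroup Γ) : 𝒳 1 ≃ₗ[O] truncGrading 𝒳 Λ 1 :=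
  (Submodule.submoduleOfEquivOfLe (le_truncModule Λ.one_mem)).symm

variable {b : O[ω.ker]} {b' : O[ω'.ker]}

lemma IsBlockModule.trunc (h : IsBlockModule ω ω' b b' ρ 𝒳) (Λ : Subgroup Γ) :
    IsBlockModule (ω.subgroupComap Λ) (ω'.subgroupComap Λ) (truncBlock ω Λ b)
      (truncBlock ω' Λ b') (truncRep h.graded Λ) (truncGrading 𝒳 Λ) where
  block := h.block.trunc
  block' := h.block'.trunc
  graded := h.graded.trunc Λ
  left_one := LinearMap.ext fun m => Subtype.ext (by
    rw [leftHom_truncRep, inclHom_extend, h.left_one]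
    rfl)
  right_one := MulOpposite.unop_injective <| LinearMap.ext fun m => Subtype.ext (by
    rw [rightHom_truncRep, inclHom_extend, h.right_one]
    rfl)
  finite := by
    have := h.finite
    exact Module.Finite.equiv (truncOneEquiv 𝒳 Λ)
  indecomposable := h.indecomposable.of_equiv
    ((truncKerEquiv ω Λ).prodCongr (truncKerEquiv ω' Λ)) (truncOneEquiv 𝒳 Λ) fun _ _ => rfl
  projective_left := projective_asModule_of_equiv (truncKerEquiv ω Λ) (truncOneEquiv 𝒳 Λ)
    (fun _ _ => rfl) h.projective_left
  projective_right := projective_asModule_of_equiv (truncKerEquiv ω' Λ) (truncOneEquiv 𝒳 Λ)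
    (fun _ _ => rfl) h.projective_right

lemma IsBlockModule.trunc_isTrunc (h : IsBlockModule ω ω' b b' ρ 𝒳) {Λ : Subgroup Γ}
    (h₀ : IsBlockModule (ω.subgroupComap Λ) (ω'.subgroupComap Λ) (truncBlock ω Λ b)
      (truncBlock ω' Λ b') (truncRep h.graded Λ) (truncGrading 𝒳 Λ)) :
    (blockBimod h₀.block h₀.block' (truncRep h.graded Λ) h₀.left_one h₀.right_one).IsTrunc
      (blockBimod h.block h.block' ρ h.left_one h.right_one)
      (blockIncl h.block h₀.block) (blockIncl h.block' h₀.block') where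
  left a x := leftHom_truncRep h.graded Λ a.1 x
  right a x := rightHom_truncRep h.graded Λ a.1 x

/-- The condition on the projections of vertices passes to the truncation. -/
lemma IsBlockModule.sigma_trunc_bijective [IsNoetherianRing O] [IsLocalRing O]
    [IsAdicComplete (IsLocalRing.maximalIdeal O) O] [Finite G] [Finite G']
    (h : IsBlockModule ω ω' b b' ρ 𝒳)
    (hσ : ∀ P, IsVertex (oneComponent h.graded) P → Function.Bijective (sigma ω ω' P))
    {Λ : Subgroup Γ} {P : Subgroup (diag (ω.subgroupComap Λ) (ω'.subgroupComap Λ))}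
    (hP : IsVertex (oneComponent (h.graded.trunc Λ)) P) :
    Function.Bijective (sigma (ω.subgroupComap Λ) (ω'.subgroupComap Λ) P) := by
  refine ⟨?_, MonoidHom.subgroupMap_surjective _ _⟩
  have := h.finite
  -- The `1`-component of the truncation is the restriction of `M` along `diagIncl`, and it remains
  -- indecomposable over the kernels.
  have hind : IsIndecomposable (((oneComponent h.graded).comp (diagIncl ω ω' Λ)).comp
      (kerProd (ω.subgroupComap Λ) (ω'.subgroupComap Λ))) :=
    (h.trunc Λ).indecomposable.of_equiv id (truncOneEquiv 𝒳 Λ).symm fun _ _ => rfl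
  have hP' : IsVertex ((oneComponent h.graded).comp (diagIncl ω ω' Λ)) P :=
    hP.of_equiv (truncOneEquiv 𝒳 Λ).symm fun _ _ => rfl
  obtain ⟨Q, hQ⟩ := exists_isVertex (oneComponent h.graded)
  obtain ⟨g, hg⟩ := hP'.exists_conj_mem hind hQ.1
  rw [injective_iff_map_eq_one]
  intro x hx
  have hx1 : (x.1.1.1 : G) = 1 :=
    congrArg (fun y => (y.1 : G)) hx
  -- Conjugation keeps the trivial first coordinate, so the conjugate of `x` in `Q` lies in the
  -- kernel of the projection.
  have h1 : sigma ω ω' Q ⟨_, hg x x.2⟩ = 1 := by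
    refine Subtype.ext ?_
    change (g⁻¹ * diagIncl ω ω' Λ x * g : diag ω ω').1.1 = 1
    change (g.1.1)⁻¹ * (x.1.1.1 : G) * g.1.1 = 1
    rw [hx1, mul_one, inv_mul_cancel]
  have h2 := congrArg Subtype.val
    ((injective_iff_map_eq_one _).mp (hσ Q hQ).1 _ h1)
  have h3 : diagIncl ω ω' Λ x = 1 := by
    have h4 : g⁻¹ * diagIncl ω ω' Λ x * g = 1 := h2
    rwa [mul_eq_one_iff_eq_inv, mul_eq_left] at h4
  refine Subtype.ext (Subtype.ext (Prod.ext (Subtype.ext ?_) (Subtype.ext ?_)))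
  · exact congrArg (fun y => y.1.1) h3
  · exact congrArg (fun y => y.1.2) h3

end TruncRep

end GradedMorita

end

theorem corollaryc {O : Type*} [CommRing O] [IsDomain O] [IsDiscreteValuationRing O]
    [IsAdicComplete (IsLocalRing.maximalIdeal O) O] [CharZero O]
    (p : ℕ) [Fact p.Prime] [CharP (IsLocalRing.ResidueField O) p]
    {G G' Γ : Type*} [Group G] [Finite G] [Group G'] [Finite G'] [Group Γ]
    (ω : G →* Γ) (hω : Function.Surjective ω) (ω' : G' →* Γ) (hω' : Function.Surjective ω')
    (b : MonoidAlgebra O ω.ker) (b' : MonoidAlgebra O ω'.ker)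
    {X : Type*} [AddCommGroup X] [Module O X]
    (ρ : Representation O (G × G') X) (𝒳 : Γ → Submodule O X)
    (hX : GradedMorita.DeterminesBasicGradedMorita ω ω' b b' ρ 𝒳)
    (Λ : Subgroup Γ) :
    GradedMorita.DeterminesBasicGradedMorita
      (ω.subgroupComap Λ) (ω'.subgroupComap Λ)
      (GradedMorita.truncBlock ω Λ b) (GradedMorita.truncBlock ω' Λ b')
      (GradedMorita.truncRep hX.graded Λ) (GradedMorita.truncGrading 𝒳 Λ) := by
  -- Finiteness makes the sum over cosets of `Λ` in `tensorTrunc_injective` available.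
  have : Finite Γ := Finite.of_surjective ω hω
  have h₀ := hX.toIsBlockModule.trunc Λ
  exact
    { toIsBlockModule := h₀
      morita := hX.morita.trunc (hX.toIsBlockModule.trunc_isTrunc h₀)
        (GradedMorita.blockIncl_isTruncAlg hω hX.block h₀.block)
        (GradedMorita.blockIncl_isTruncAlg hω' hX.block' h₀.block')
      basic := fun _ hP => hX.toIsBlockModule.sigma_trunc_bijective hX.basic hP }
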